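/- For $k\ge 1$ let $G_{k+5}$ be the graph on $\{1,\dots,k+5\}$ with the $2k+5$ edges $\{1,3\}$, $\{2,4\}$, $\{3,4\}$, $\{1,k+4\}$, $\{3,k+4\}$, $\{2,k+5\}$, $\{4,k+5\}$, and $\{1,j\}$, $\{2,j\}$ for $5\le j\le k+3$. For a finite simple graph $G$ on $[d]=\{1,\dots,d\}$ with edges $e_1,\dots,e_n$ and a field $K$, let $K[G]\subset K[t_1,\dots,t_d]$ be the edge ring, i.e. the $K$-subalgebra generated by the monomials $\mathbf t^{e}=t_it_j$, $e=\{i,j\}$ an edge of $G$. Let $K[\mathbf x]=K[x_1,\dots,x_n]$ and let the toric ideal $I_G$ be the kernel of the $K$-algebra homomorphism $K[\mathbf x]\to K[G]$, $x_i\mapsto \mathbf t^{e_i}$. For a monomial order $<$, $\mathrm{in}_<(I_G)$ denotes the initial ideal of $I_G$. For a homogeneous ideal $J\subset K[\mathbf x]$, the depth of $K[\mathbf x]/J$ is the maximal length of a $K[\mathbf x]/J$-regular sequence in $(x_1,\dots,x_n)$, and $K[\mathbf x]/J$ is Cohen–Macaulay if its depth equals its Krull dimension. **Theorem 0.1.**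 Let $f$ and $d$ be integers with $6\le f\le d$. There is a finite connected nonbipartite graph $G$ on $[d]$, namely the graph obtained from $G_{d-f+6}$ by adding the $f-6$ pendant edges $\{1,\,d-f+6+i\}$, $i=1,\dots,f-6$, together with a (graded) reverse lexicographic order $<_{\mathrm{rev}}$ and a lexicographic order $<_{\mathrm{lex}}$ on the monomials in $x_1,\dots,x_n$ (each induced by some ordering of the variables), such that for every field $K$: 1. $K[G]$ is normal; 2. $\operatorname{depth} K[\mathbf x]/\mathrm{in}_{<_{\mathrm{rev}}}(I_G)=f$; 3. $K[\mathbf x]/\mathrm{in}_{<_{\mathrm{lex}}}(I_G)$ is Cohen–Macaulay. -/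

import Mathlib

noncomputable section

namespace EdgeRing

open MvPolynomial

/-! ### Edge rings and toric ideals of graphs -/

section Toric

variable {V : Type*} (K : Type*) [Field K] (G : SimpleGraph V)

/-- The quadratic monomial `t^e = t_i t_j` of `K[t]` attached to an edge `e = {i, j}` of `G`. -/
def edgeMonomial (e : G.edgeSet) : MvPolynomial V K :=
  Sym2.lift ⟨fun i j => X i * X j, fun i j => mul_comm (X i) (X j)⟩ (e : Sym2 V)

/-- The edge ring `K[G]`: the subring of `K[t]` generated over `K` by the monomials `t^e`,
`e` running over the edges of `G`. -/
def edgeRing : Subalgebra K (MvPolynomial V K) :=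
  Algebra.adjoin K (Set.range (edgeMonomial K G))

/-- The toric ideal `I_G`: the kernel of the `K`-algebra homomorphism `K[x] → K[t]`,
`x_e ↦ t^e` (its image is `K[G]`). The polynomial ring `K[x]` has one variable per edge. -/
def toricIdeal : Ideal (MvPolynomial G.edgeSet K) :=
  RingHom.ker (aeval (edgeMonomial K G) : MvPolynomial G.edgeSet K →ₐ[K] MvPolynomial V K)

end Toric

/-! ### Monomial orders and initial ideals -/

section Orders

open scoped MonomialOrder

variable {σ : Type*}

/-- `m` is the (graded) reverse lexicographic order induced by some ordering
`x 0 > x 1 > ⋯ > x (n - 1)` of the variables: `x^a < x^b` iff `deg a < deg b`, or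
`deg a = deg b` and the last nonzero entry of `b - a` is negative. -/
def IsReverseLexOrder (m : MonomialOrder σ) : Prop :=
  ∃ (n : ℕ) (x : Fin n ≃ σ), ∀ a b : σ →₀ ℕ,
    a ≺[m] b ↔
      a.degree < b.degree ∨
        (a.degree = b.degree ∧
          ∃ i : Fin n, b (x i) < a (x i) ∧ ∀ j : Fin n, i < j → a (x j) = b (x j))

/-- `m` is the lexicographic order induced by some ordering `x 0 > x 1 > ⋯ > x (n - 1)` of the
variables: `x^a < x^b` iff the first nonzero entry of `b - a` is positive. -/
def IsLexOrder (m : MonomialOrder σ) : Prop :=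
  ∃ (n : ℕ) (x : Fin n ≃ σ), ∀ a b : σ →₀ ℕ,
    a ≺[m] b ↔
      ∃ i : Fin n, a (x i) < b (x i) ∧ ∀ j : Fin n, j < i → a (x j) = b (x j)

/-- The initial ideal of `I`: the ideal generated by the leading terms of its elements. -/
def initialIdeal {K : Type*} [Field K] (m : MonomialOrder σ) (I : Ideal (MvPolynomial σ K)) :
    Ideal (MvPolynomial σ K) :=
  Ideal.span (m.leadingTerm '' (I : Set (MvPolynomial σ K)))

end Orders

/-! ### Depth and Cohen-Macaulayness of quotients `K[x]/J` -/

/-- The supremum of the lengths of the `M`-regular sequences contained in the ideal `I`. -/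
def depthIn {R : Type*} [CommRing R] (I : Ideal R) (M : Type*) [AddCommGroup M] [Module R M] :
    ℕ∞ :=
  ⨆ rs : {rs : List R // RingTheory.Sequence.IsRegular M rs ∧ ∀ r ∈ rs, r ∈ I},
    ((rs : List R).length : ℕ∞)

section Quotient

variable {σ K : Type*} [Field K]

/-- The depth of `K[x]/J`, for a homogeneous ideal `J`: the maximal length of a
`K[x]/J`-regular sequence contained in the graded maximal ideal `(x_1, …, x_n)`. -/
def depthQuotient (J : Ideal (MvPolynomial σ K)) : ℕ∞ :=
  depthIn (Ideal.span (Set.range (X : σ → MvPolynomial σ K))) (MvPolynomial σ K ⧸ J)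

/-- `K[x]/J`, for a homogeneous ideal `J`, is Cohen-Macaulay: its depth equals its Krull
dimension. -/
def IsCohenMacaulayQuotient (J : Ideal (MvPolynomial σ K)) : Prop :=
  ((depthQuotient J : ℕ∞) : WithBot ℕ∞) = ringKrullDim (MvPolynomial σ K ⧸ J)

end Quotient

/-! ### The graphs -/

/-- The edges `{a, b}`, `a < b`, of the graph `G_{k+5}` on `{1, …, k+5}` (`k ≥ 1`): the vertex `1`
is joined to `3`, `5, …, k+3` and `k+4`; the vertex `2` is joined to `4`, `5, …, k+3` and `k+5`;
further edges are `{3, 4}`, `{3, k+4}` and `{4, k+5}`. -/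
def CoreEdge (k a b : ℕ) : Prop :=
  (a = 1 ∧ (b = 3 ∨ (5 ≤ b ∧ b ≤ k + 3) ∨ b = k + 4)) ∨
  (a = 2 ∧ (b = 4 ∨ (5 ≤ b ∧ b ≤ k + 3) ∨ b = k + 5)) ∨
  (a = 3 ∧ (b = 4 ∨ b = k + 4)) ∨
  (a = 4 ∧ b = k + 5)

/-- For `1 ≤ k` and `k + 5 ≤ d`: the graph on `[d]` obtained from `G_{k+5}` by attaching to the
vertex `1` the pendant edges `{1, b}`, `k + 5 < b ≤ d`. The vertex `v : Fin d` stands for the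
element `v + 1` of `[d] = {1, …, d}`. -/
def pendantGraph (k d : ℕ) : SimpleGraph (Fin d) :=
  SimpleGraph.fromRel fun u v =>
    CoreEdge k ((u : ℕ) + 1) ((v : ℕ) + 1) ∨ ((u : ℕ) + 1 = 1 ∧ k + 5 < (v : ℕ) + 1)

end EdgeRing

end

/-!
The edge variables are named `p, q, r` and `u, v, w` (two triangles, at the vertices `1` and `2`),
`s` (the edge joining the triangles), `a_j, b_j` (the two halves of the paths joining `1` to `2`)
and `z_i` (the pendant edges). Two monomials have the same image in `K[t]` exactly if their
exponents satisfy the vertex equations `SameFibre`, and the initial ideal of a toric ideal is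
spanned by the monomials that are not minimal in their fibre (`initialIdeal_ker_toric`). So a
monomial ideal is the initial ideal as soon as each of its generators shares its fibre with a
smaller monomial, while two monomials outside it never share a fibre. For the reverse
lexicographic order with smallest variables `a_0 > a_1 > ⋯ > p > r` this gives
`(q s b_j, s v a_j, q v s², p q w b_i b_j, a_i b_j (i < j))`, and for the lexicographic order with
`r > p > a_0 > a_1 > ⋯` it gives `(r u a_j, p w b_j, p r u w, a_i b_j (i < j))`.

The depth of `K[x] / J` for such a monomial ideal `J` is found from two sides. A regular sequence is
no longer than `dim K[x] / P` for an associated prime `P` of `J`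
(`length_le_ringKrullDim_of_isAssociatedPrime`), and `P = J : x^γ` is generated by variables for
`x^γ = q s v`, respectively `x^γ = p r u`. Conversely, an explicit list of linear forms is regular:
by the exact sequences `0 → R/(J : x) → R/J → R/(J + (x)) → 0` this reduces, one variable `x` at a
time, to ideals generated by variables (`IsRegularModMono.pivot`), where it says that the forms are
linearly independent modulo these variables. The first bound and the number of forms agree: they
are `f` for the reverse lexicographic order and `d` for the lexicographic one. In the latter case
every prime over the initial ideal contains `d - f + 1` of the variables, so the dimension is `d`
as well.

The edge ring depends only on the fibres, and it is isomorphic to the semigroup ring of the values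
of finitely many nonnegative linear forms (`supportForms`). The value semigroup contains every
difference of two of its elements that has nonnegative coordinates, hence a quotient of elements of
its ring that is a polynomial lies in the ring again, and the ring is integrally closed because the
polynomial ring is.
-/

noncomputable section

namespace EdgeRing

open MvPolynomial

open scoped MonomialOrder

/-! ### Weakly regular sequences on cyclic modules -/

section WeaklyRegular

variable {R : Type*} [CommRing R]

/-- The list `x₁, …, xₙ` is weakly regular on `R ⧸ J`, phrased inside `R`: each `xᵢ` is a
nonzerodivisor modulo `J + (x₁, …, xᵢ₋₁)`. -/
def IsWeaklyRegularMod : Ideal R → List R → Prop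
  | _, [] => True
  | J, x :: xs => (∀ f, x * f ∈ J → f ∈ J) ∧ IsWeaklyRegularMod (J ⊔ Ideal.span {x}) xs

open Pointwise in
theorem IsWeaklyRegularMod.isWeaklyRegular {J : Ideal R} {rs : List R}
    (h : IsWeaklyRegularMod J rs) : RingTheory.Sequence.IsWeaklyRegular (R ⧸ J) rs := by
  induction rs generalizing J with
  | nil => simp
  | cons x xs ih =>
    rw [RingTheory.Sequence.isWeaklyRegular_cons_iff]
    refine ⟨?_, ?_⟩
    · refine isSMulRegular_iff_right_eq_zero_of_smul.2 fun y => ?_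
      obtain ⟨f, rfl⟩ := Ideal.Quotient.mk_surjective y
      intro hf
      rw [← Ideal.Quotient.mk_eq_mk, ← Submodule.Quotient.mk_smul] at hf
      exact Ideal.Quotient.eq_zero_iff_mem.2 (h.1 f (Ideal.Quotient.eq_zero_iff_mem.1 hf))
    · have e₁ : (x • ⊤ : Submodule R (R ⧸ J)) =
          Submodule.map (Submodule.mkQ J) (Ideal.span {x}) := by
        rw [Submodule.map_span, Set.image_singleton]
        ext y
        rw [Submodule.mem_smul_pointwise_iff_exists, Submodule.mem_span_singleton]
        constructor
        · rintro ⟨b, -, rfl⟩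
          obtain ⟨f, rfl⟩ := Ideal.Quotient.mk_surjective b
          exact ⟨f, by
            rw [← Ideal.Quotient.mk_eq_mk, ← Submodule.Quotient.mk_smul, Submodule.mkQ_apply,
              ← Submodule.Quotient.mk_smul, smul_eq_mul, smul_eq_mul, mul_comm]⟩
        · rintro ⟨f, rfl⟩
          exact ⟨Ideal.Quotient.mk J f, trivial, by
            rw [← Ideal.Quotient.mk_eq_mk, ← Submodule.Quotient.mk_smul, Submodule.mkQ_apply,
              ← Submodule.Quotient.mk_smul, smul_eq_mul, smul_eq_mul, mul_comm]⟩
      let e : QuotSMulTop x (R ⧸ J) ≃ₗ[R] R ⧸ (J ⊔ Ideal.span {x}) :=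
        (Submodule.quotEquivOfEq _ _ e₁).trans
          (Submodule.quotientQuotientEquivQuotientSup J (Ideal.span {x}))
      rw [e.isWeaklyRegular_congr]
      exact ih h.2

/-- Weak regularity passes from the outer terms of
`0 → R ⧸ (J : z) → R ⧸ J → R ⧸ (J + (z)) → 0` to the middle term. -/
theorem IsWeaklyRegularMod.of_colon_of_sup {rs : List R} {J J₁ J₂ : Ideal R} (z : R)
    (hJ₁ : ∀ f, f ∈ J₁ ↔ z * f ∈ J) (hJ₂ : J ⊔ Ideal.span {z} = J₂)
    (h₁ : IsWeaklyRegularMod J₁ rs) (h₂ : IsWeaklyRegularMod J₂ rs) :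
    IsWeaklyRegularMod J rs := by
  induction rs generalizing J J₁ J₂ with
  | nil => trivial
  | cons x xs ih =>
    subst hJ₂
    refine ⟨fun f hf => ?_, ih (J₁ := J₁ ⊔ Ideal.span {x}) ?_ ?_ h₁.2 h₂.2⟩
    · have h := h₂.1 f (Ideal.mem_sup_left hf)
      rw [Submodule.mem_sup] at h
      obtain ⟨j, hj, y, hy, rfl⟩ := h
      obtain ⟨g, rfl⟩ := Ideal.mem_span_singleton'.1 hy
      refine J.add_mem hj ?_
      rw [mul_comm, ← hJ₁]
      refine h₁.1 g ((hJ₁ _).2 ?_)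
      have : z * (x * g) = x * (j + g * z) - x * j := by ring
      rw [this]
      exact J.sub_mem hf (J.mul_mem_left _ hj)
    · intro f
      constructor
      · intro hf
        obtain ⟨j, hj, y, hy, rfl⟩ := Submodule.mem_sup.1 hf
        obtain ⟨g, rfl⟩ := Ideal.mem_span_singleton'.1 hy
        rw [mul_add]
        refine Ideal.add_mem _ (Ideal.mem_sup_left ((hJ₁ j).1 hj)) (Ideal.mem_sup_right ?_)
        exact Ideal.mem_span_singleton'.2 ⟨z * g, by ring⟩
      · intro hf
        obtain ⟨j, hj, y, hy, hjy⟩ := Submodule.mem_sup.1 hf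
        obtain ⟨g, rfl⟩ := Ideal.mem_span_singleton'.1 hy
        have hg : g ∈ J ⊔ Ideal.span {z} := by
          refine h₂.1 g ?_
          have : x * g = z * f - j := by rw [← hjy]; ring
          rw [this]
          exact Ideal.sub_mem _ (Ideal.mem_sup_right (Ideal.mem_span_singleton'.2 ⟨f, by ring⟩))
            (Ideal.mem_sup_left hj)
        obtain ⟨j', hj', y', hy', rfl⟩ := Submodule.mem_sup.1 hg
        obtain ⟨g', rfl⟩ := Ideal.mem_span_singleton'.1 hy'
        have hmem : f - g' * x ∈ J₁ := by
          rw [hJ₁]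
          have : z * (f - g' * x) = j + x * j' := by linear_combination -hjy
          rw [this]
          exact J.add_mem hj (J.mul_mem_left _ hj')
        have : f = (f - g' * x) + g' * x := by ring
        rw [this]
        exact Ideal.add_mem _ (Ideal.mem_sup_left hmem)
          (Ideal.mem_sup_right (Ideal.mem_span_singleton'.2 ⟨g', rfl⟩))
    · rw [sup_assoc, sup_assoc, sup_comm (Ideal.span {x})]

end WeaklyRegular

/-! ### Associated primes bound the length of regular sequences -/

section Depth

variable {R : Type*} [CommRing R] [IsNoetherianRing R]

open Pointwise in
/-- If `x ∈ 𝔪` is a nonzerodivisor on the finite module `M`, then every associated prime `P ⊆ 𝔪`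
of `M` is strictly contained in an associated prime `Q ⊆ 𝔪` of `M ⧸ xM`. -/
theorem exists_associatedPrime_quotSMulTop_gt {M : Type*} [AddCommGroup M] [Module R M]
    [Module.Finite R M] {𝔪 P : Ideal R} [𝔪.IsPrime] {x : R} (hx : x ∈ 𝔪)
    (hreg : IsSMulRegular M x) (hP : IsAssociatedPrime P M) (hP𝔪 : P ≤ 𝔪) :
    ∃ Q : Ideal R, IsAssociatedPrime Q (QuotSMulTop x M) ∧ P < Q ∧ Q ≤ 𝔪 := by
  classical
  obtain ⟨hPp, u, hu⟩ := isAssociatedPrime_iff.1 hP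
  have hu' : ∀ y, y ∈ P ↔ y • u = 0 := fun y => by
    rw [hu, Submodule.mem_colon_singleton, Submodule.mem_bot]
  let N : Submodule R M :=
    { carrier := {n | ∀ y ∈ P, y • n = 0}
      add_mem' := fun {a b} ha hb y hy => by rw [smul_add, ha y hy, hb y hy, add_zero]
      zero_mem' := fun y _ => smul_zero y
      smul_mem' := fun c n hn y hy => by rw [smul_comm, hn y hy, smul_zero] }
  have huN : u ∈ N := fun y hy => (hu' y).1 hy
  have hdiv : ∀ n : M, x • n ∈ N → n ∈ N := fun n hn y hy => hreg (by
    change x • y • n = x • (0 : M)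
    rw [smul_comm, hn y hy, smul_zero])
  have key : ∃ n ∈ N, ∀ t : R, t • n ∈ (x • ⊤ : Submodule R M) → t ∈ 𝔪 := by
    by_contra! hcon
    -- Otherwise some `t ∉ 𝔪` satisfies `t N ⊆ x N`; Cayley-Hamilton contradicts `P ⊆ 𝔪`.
    obtain ⟨t, ht, htN⟩ : ∃ t ∉ 𝔪, ∀ n ∈ N, t • n ∈ (x • ⊤ : Submodule R M) := by
      obtain ⟨S, hS⟩ : N.FG := IsNoetherian.noetherian N
      have hSN : ∀ n ∈ S, n ∈ N := fun n hn => hS ▸ Submodule.subset_span hn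
      choose! c hc hc' using hcon
      refine ⟨∏ n ∈ S, c n, fun h => ?_, fun n hn => ?_⟩
      · obtain ⟨n, hn, hn'⟩ := (Ideal.IsPrime.prod_mem_iff).1 h
        exact hc' n (hSN n hn) hn'
      · rw [← hS] at hn
        induction hn using Submodule.span_induction with
        | mem n hn =>
          rw [← Finset.prod_erase_mul _ _ hn, mul_smul]
          exact Submodule.smul_mem _ _ (hc n (hSN n hn))
        | zero => simp
        | add a b _ _ ha hb => rw [smul_add]; exact Submodule.add_mem _ ha hb
        | smul r a _ ha => rw [smul_comm]; exact Submodule.smul_mem _ _ ha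
    have hrange : LinearMap.range (LinearMap.lsmul R N t) ≤ Ideal.span {x} • ⊤ := by
      rintro _ ⟨n, rfl⟩
      obtain ⟨n', -, hn'⟩ := (Submodule.mem_smul_pointwise_iff_exists _ _ _).1 (htN n n.2)
      have hn'N : n' ∈ N := hdiv n' (by rw [hn']; exact N.smul_mem t n.2)
      have : LinearMap.lsmul R N t n = x • (⟨n', hn'N⟩ : N) := Subtype.ext hn'.symm
      rw [this]
      exact Submodule.smul_mem_smul (Ideal.mem_span_singleton_self x) trivial
    obtain ⟨g, hg, -, hcoeff, hg0⟩ :=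
      LinearMap.exists_monic_and_natDegree_eq_and_coeff_mem_pow_and_aeval_eq_zero R
        (LinearMap.lsmul R N t) (Ideal.span {x}) hrange
    have hg1 : g.eval t • (⟨u, huN⟩ : N) = 0 := by
      have h1 := LinearMap.congr_fun hg0 ⟨u, huN⟩
      have h2 : Polynomial.aeval (LinearMap.lsmul R N t) g = LinearMap.lsmul R N (g.eval t) := by
        have : LinearMap.lsmul R N t = algebraMap R (Module.End R N) t := rfl
        rw [this, Polynomial.aeval_algebraMap_apply]
        simp
        rfl
      rw [h2] at h1
      exact h1
    have hgP : g.eval t ∈ 𝔪 := hP𝔪 ((hu' _).2 (congrArg Subtype.val hg1))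
    rw [Polynomial.eval_eq_sum_range, Finset.sum_range_succ, hg.coeff_natDegree, one_mul] at hgP
    refine ht (Ideal.IsPrime.mem_of_pow_mem ‹_› g.natDegree
      ((Submodule.add_mem_iff_right _ ?_).1 hgP))
    refine Submodule.sum_mem _ fun i hi => Ideal.mul_mem_right _ _ ?_
    have h1 : g.coeff i ∈ Ideal.span {x} :=
      Ideal.pow_le_self (by have := Finset.mem_range.1 hi; omega) (hcoeff i)
    exact (Ideal.span_singleton_le_iff_mem 𝔪).2 hx h1
  obtain ⟨n, hnN, hn⟩ := key
  let nbar : QuotSMulTop x M := Submodule.Quotient.mk n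
  have hnbar : ∀ t : R, t • nbar = 0 ↔ t • n ∈ (x • ⊤ : Submodule R M) := fun t => by
    rw [← Submodule.Quotient.mk_eq_zero, Submodule.Quotient.mk_smul]
  have hle : (⊥ : Submodule R (QuotSMulTop x M)).colon {nbar} ≤ 𝔪 := fun t ht => by
    rw [Submodule.mem_colon_singleton, Submodule.mem_bot, hnbar] at ht
    exact hn t ht
  obtain ⟨Q, hQ, hQ𝔪⟩ := Ideal.exists_minimalPrimes_le hle
  have hQc := hQ.1.2
  refine ⟨Q, isAssociatedPrime_iff.2 ⟨hQ.1.1, ?_⟩, ?_, hQ𝔪⟩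
  · exact Submodule.exists_eq_colon_of_mem_minimalPrimes hQ
  · have hPQ : P ≤ Q := fun y hy => hQc (by
      rw [Submodule.mem_colon_singleton, Submodule.mem_bot, hnbar, hnN y hy]
      exact Submodule.zero_mem _)
    refine lt_of_le_of_ne hPQ fun h => ?_
    have hxQ : x ∈ Q := hQc (by
      rw [Submodule.mem_colon_singleton, Submodule.mem_bot, hnbar]
      exact Submodule.smul_mem_pointwise_smul _ _ _ trivial)
    rw [← h, hu'] at hxQ
    have hu0 : u = 0 := hreg (by simpa using hxQ)
    exact hPp.ne_top ((Ideal.eq_top_iff_one _).2 ((hu' 1).2 (by simp [hu0])))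

/-- A weakly regular sequence inside the prime `𝔪` is no longer than the coheight of any
associated prime contained in `𝔪`. -/
theorem length_le_coheight_of_isAssociatedPrime {M : Type*} [AddCommGroup M] [Module R M]
    [Module.Finite R M] {𝔪 P : Ideal R} [𝔪.IsPrime] {rs : List R}
    (hreg : RingTheory.Sequence.IsWeaklyRegular M rs) (hrs : ∀ x ∈ rs, x ∈ 𝔪)
    (hP : IsAssociatedPrime P M) (hP𝔪 : P ≤ 𝔪) :
    (rs.length : ℕ∞) ≤ Order.coheight (⟨P, hP.isPrime⟩ : PrimeSpectrum R) := by
  induction rs generalizing M P with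
  | nil => simp
  | cons x xs ih =>
    rw [RingTheory.Sequence.isWeaklyRegular_cons_iff] at hreg
    obtain ⟨Q, hQ, hPQ, hQ𝔪⟩ :=
      exists_associatedPrime_quotSMulTop_gt (hrs x (by simp)) hreg.1 hP hP𝔪
    have h1 := ih hreg.2 (fun y hy => hrs y (by simp [hy])) hQ hQ𝔪
    have h2 : (⟨P, hP.isPrime⟩ : PrimeSpectrum R) < ⟨Q, hQ.isPrime⟩ := hPQ
    refine le_trans ?_ (Order.coheight_add_one_le h2)
    rw [List.length_cons, Nat.cast_add, Nat.cast_one]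
    gcongr

theorem coheight_eq_ringKrullDim_quotient {R : Type*} [CommRing R] (P : PrimeSpectrum R) :
    (Order.coheight P : WithBot ℕ∞) = ringKrullDim (R ⧸ P.asIdeal) := by
  rw [ringKrullDim_quotient, Order.coheight_eq_krullDim_Ici]
  exact Order.krullDim_eq_of_orderIso (OrderIso.refl _)

theorem length_le_ringKrullDim_of_isAssociatedPrime {M : Type*} [AddCommGroup M] [Module R M]
    [Module.Finite R M] {𝔪 P : Ideal R} [𝔪.IsPrime] {rs : List R}
    (hreg : RingTheory.Sequence.IsWeaklyRegular M rs) (hrs : ∀ x ∈ rs, x ∈ 𝔪)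
    (hP : IsAssociatedPrime P M) (hP𝔪 : P ≤ 𝔪) :
    (((rs.length : ℕ) : ℕ∞) : WithBot ℕ∞) ≤ ringKrullDim (R ⧸ P) :=
  (WithBot.coe_le_coe.2 (length_le_coheight_of_isAssociatedPrime hreg hrs hP hP𝔪)).trans
    (coheight_eq_ringKrullDim_quotient ⟨P, hP.isPrime⟩).le

end Depth

/-! ### Ideals generated by linear forms -/

section LinearForms

variable {σ K : Type*} [Fintype σ] [Field K]

/-- The linear form `∑ x, v x • X x` with coefficient vector `v`. -/
def linForm : (σ → K) →ₗ[K] MvPolynomial σ K :=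
  Fintype.linearCombination K (X : σ → MvPolynomial σ K)

theorem linForm_apply (v : σ → K) :
    linForm v = ∑ x, v x • (X x : MvPolynomial σ K) := rfl

theorem linForm_single [DecidableEq σ] (x : σ) : linForm (Pi.single x (1 : K)) = X x := by
  rw [linForm, Fintype.linearCombination_apply_single, one_smul]

/-- The ideal generated by the linear forms with coefficient vectors in `W`. -/
def linIdeal (W : Submodule K (σ → K)) : Ideal (MvPolynomial σ K) :=
  Ideal.span (linForm '' (W : Set (σ → K)))

/-- Modulo an ideal generated by linear forms, the polynomial ring is again a polynomial ring, on a
basis of the quotient of the space of linear forms. -/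
theorem exists_algHom_ker_eq_linIdeal (W : Submodule K (σ → K)) :
    ∃ φ : MvPolynomial σ K →ₐ[K] MvPolynomial (Fin (Module.finrank K ((σ → K) ⧸ W))) K,
      Function.Surjective φ ∧ RingHom.ker φ = linIdeal W ∧ ∀ v, φ (linForm v) = 0 ↔ v ∈ W := by
  classical
  let B := Module.finBasis K ((σ → K) ⧸ W)
  let φ : MvPolynomial σ K →ₐ[K] MvPolynomial (Fin (Module.finrank K ((σ → K) ⧸ W))) K :=
    aeval fun x => linForm (B.equivFun (W.mkQ (Pi.single x 1)))
  have hφ : ∀ v, φ (linForm v) = linForm (B.equivFun (W.mkQ v)) := by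
    intro v
    have : φ.toLinearMap ∘ₗ linForm =
        linForm ∘ₗ B.equivFun.toLinearMap ∘ₗ W.mkQ := by
      refine LinearMap.pi_ext' fun x => LinearMap.ext_ring ?_
      simp only [LinearMap.comp_apply, LinearMap.single_apply, LinearEquiv.coe_coe,
        AlgHom.toLinearMap_apply, linForm_single]
      exact aeval_X _ _
    exact LinearMap.congr_fun this v
  choose L hL using Submodule.mkQ_surjective W
  let ψ : MvPolynomial (Fin (Module.finrank K ((σ → K) ⧸ W))) K →ₐ[K] MvPolynomial σ K :=
    aeval fun i => linForm (L (B i))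
  have hφψ : φ.comp ψ = AlgHom.id K _ := by
    refine MvPolynomial.algHom_ext fun i => ?_
    rw [AlgHom.comp_apply, aeval_X, hφ, hL, AlgHom.id_apply, ← linForm_single]
    congr 1
    funext j
    rw [Module.Basis.equivFun_self, Pi.single_apply]
    simp [eq_comm]
  have hψlin : ∀ c, ψ (linForm c) = linForm (∑ i, c i • L (B i)) := by
    intro c
    rw [linForm_apply, map_sum, map_sum]
    refine Finset.sum_congr rfl fun i _ => ?_
    rw [map_smul, map_smul, aeval_X]
  have hψφ : (Ideal.Quotient.mkₐ K (linIdeal W)).comp (ψ.comp φ) =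
      Ideal.Quotient.mkₐ K (linIdeal W) := by
    refine MvPolynomial.algHom_ext fun x => ?_
    rw [AlgHom.comp_apply, AlgHom.comp_apply, ← linForm_single, hφ, hψlin,
      Ideal.Quotient.mkₐ_eq_mk, Ideal.Quotient.eq, ← map_sub]
    refine Ideal.subset_span ⟨_, ?_, rfl⟩
    refine (Submodule.Quotient.mk_eq_zero W).1 ?_
    rw [← Submodule.mkQ_apply, map_sub, map_sum, sub_eq_zero]
    simp_rw [map_smul, hL]
    exact B.sum_equivFun _
  refine ⟨φ, fun y => ⟨ψ y, AlgHom.congr_fun hφψ y⟩, le_antisymm ?_ ?_, ?_⟩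
  · intro f hf
    have h1 := AlgHom.congr_fun hψφ f
    rw [AlgHom.comp_apply, AlgHom.comp_apply, (RingHom.mem_ker).1 hf, map_zero, map_zero] at h1
    exact Ideal.Quotient.eq_zero_iff_mem.1 h1.symm
  · refine Ideal.span_le.2 ?_
    rintro _ ⟨v, hv, rfl⟩
    rw [SetLike.mem_coe, RingHom.mem_ker]
    change φ (linForm v) = 0
    rw [hφ, Submodule.mkQ_apply, (Submodule.Quotient.mk_eq_zero W).2 hv, map_zero, map_zero]
  · intro v
    rw [hφ]
    constructor
    · intro h
      have hinj : Function.Injective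
          (linForm : (Fin (Module.finrank K ((σ → K) ⧸ W)) → K) →ₗ[K] _) := by
        refine (injective_iff_map_eq_zero _).2 fun c hc => funext fun i => ?_
        have := congrArg (coeff (Finsupp.single i 1)) hc
        simpa [linForm_apply, coeff_sum, coeff_X, Finsupp.single_left_inj] using this
      have h1 := hinj (h.trans (map_zero _).symm)
      rw [LinearEquiv.map_eq_zero_iff] at h1
      exact (Submodule.Quotient.mk_eq_zero W).1 h1
    · intro hv
      rw [Submodule.mkQ_apply, (Submodule.Quotient.mk_eq_zero W).2 hv, map_zero, map_zero]

theorem linIdeal_isPrime (W : Submodule K (σ → K)) : (linIdeal W).IsPrime := by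
  obtain ⟨φ, -, h, -⟩ := exists_algHom_ker_eq_linIdeal W
  rw [← h]
  exact RingHom.ker_isPrime _

theorem linForm_mem_linIdeal {W : Submodule K (σ → K)} {v : σ → K} :
    linForm v ∈ linIdeal W ↔ v ∈ W := by
  obtain ⟨φ, -, h, h'⟩ := exists_algHom_ker_eq_linIdeal W
  rw [← h, RingHom.mem_ker, ← h']

theorem ringKrullDim_quotient_linIdeal (W : Submodule K (σ → K)) :
    ringKrullDim (MvPolynomial σ K ⧸ linIdeal W) = Module.finrank K ((σ → K) ⧸ W) := by
  obtain ⟨φ, hs, h, -⟩ := exists_algHom_ker_eq_linIdeal W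
  rw [← h]
  have e := RingHom.quotientKerEquivOfSurjective (f := φ.toRingHom) hs
  refine (ringKrullDim_eq_of_ringEquiv e).trans ?_
  simp [ringKrullDim_eq_zero_of_field]

theorem linIdeal_sup_span (W : Submodule K (σ → K)) (v : σ → K) :
    linIdeal W ⊔ Ideal.span {linForm v} = linIdeal (W ⊔ K ∙ v) := by
  refine le_antisymm (sup_le (Ideal.span_mono (Set.image_mono ?_)) ?_) ?_
  · exact (le_sup_left : W ≤ W ⊔ K ∙ v)
  · rw [Ideal.span_singleton_le_iff_mem]
    exact Ideal.subset_span
      ⟨v, (le_sup_right : K ∙ v ≤ W ⊔ K ∙ v) (Submodule.mem_span_singleton_self v), rfl⟩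
  · refine Ideal.span_le.2 ?_
    rintro _ ⟨w, hw, rfl⟩
    obtain ⟨a, ha, b, hb, rfl⟩ := Submodule.mem_sup.1 hw
    obtain ⟨c, rfl⟩ := Submodule.mem_span_singleton.1 hb
    rw [map_add, map_smul, smul_eq_C_mul]
    exact Ideal.add_mem _ (Ideal.mem_sup_left (Ideal.subset_span ⟨a, ha, rfl⟩))
      (Ideal.mem_sup_right (Ideal.mul_mem_left _ _ (Ideal.mem_span_singleton_self _)))

/-- Linear forms that are linearly independent modulo `W` are weakly regular modulo `linIdeal W`. -/
theorem isWeaklyRegularMod_linIdeal {ι : Type*} [Fintype ι] (v : ι → σ → K) (is : List ι)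
    (hnd : is.Nodup) (W : Submodule K (σ → K))
    (h : ∀ c : ι → K, (∀ i ∉ is, c i = 0) → ∑ i, c i • v i ∈ W → c = 0) :
    IsWeaklyRegularMod (linIdeal W) (is.map fun i => linForm (v i)) := by
  classical
  induction is generalizing W with
  | nil => trivial
  | cons i is ih =>
    have hi : i ∉ is := (List.nodup_cons.1 hnd).1
    refine ⟨fun f hf => ?_, ?_⟩
    · refine ((linIdeal_isPrime W).mem_or_mem hf).resolve_left fun hv => ?_
      rw [linForm_mem_linIdeal] at hv
      have := h (Pi.single i 1)
        (fun j hj => Pi.single_eq_of_ne (fun hji => hj (by simp [hji])) _)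
        (by simpa [Pi.single_apply, ite_smul] using hv)
      simpa using congrFun this i
    · rw [linIdeal_sup_span]
      refine ih (List.nodup_cons.1 hnd).2 _ fun c hc hcW => ?_
      obtain ⟨w, hw, b, hb, hwb⟩ := Submodule.mem_sup.1 hcW
      obtain ⟨t, rfl⟩ := Submodule.mem_span_singleton.1 hb
      have h1 := h (c - Pi.single i t) (fun j hj => by
        rw [List.mem_cons, not_or] at hj
        simp [hc j hj.2, Pi.single_eq_of_ne hj.1]) (by
        simp only [Pi.sub_apply, sub_smul, Finset.sum_sub_distrib, ← hwb]
        simpa [Pi.single_apply, ite_smul] using hw)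
      have h2 : c = Pi.single i t := sub_eq_zero.1 h1
      have h3 : t = 0 := by
        have := congrFun h2 i
        rw [hc i hi] at this
        simpa using this.symm
      rw [h2, h3, Pi.single_zero]

end LinearForms

/-! ### Monomial ideals -/

section Monomial

variable {σ : Type*} (K : Type*) [Field K]

/-- The monomial ideal generated by the monomials with exponent vector in `U`. -/
def monoIdeal (U : Set (σ →₀ ℕ)) : Ideal (MvPolynomial σ K) :=
  Ideal.span ((fun α => monomial α (1 : K)) '' U)

/-- The exponents of the monomials divisible by a variable from `D`. -/
def varUpper (D : Set σ) : Set (σ →₀ ℕ) := {α | ∃ x ∈ D, 0 < α x}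

variable {K}

theorem mem_monoIdeal {U : Set (σ →₀ ℕ)} (hU : IsUpperSet U) {f : MvPolynomial σ K} :
    f ∈ monoIdeal K U ↔ ∀ α ∈ f.support, α ∈ U := by
  rw [monoIdeal, mem_ideal_span_monomial_image]
  exact forall₂_congr fun α _ => ⟨fun ⟨β, hβ, h⟩ => hU h hβ, fun h => ⟨α, h, le_rfl⟩⟩

theorem monomial_mul_mem_monoIdeal {U U₁ : Set (σ →₀ ℕ)} (hU : IsUpperSet U)
    {γ : σ →₀ ℕ} (h₁ : ∀ α, α ∈ U₁ ↔ γ + α ∈ U) (f : MvPolynomial σ K) :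
    f ∈ monoIdeal K U₁ ↔ monomial γ 1 * f ∈ monoIdeal K U := by
  have hU₁ : IsUpperSet U₁ := fun α β hαβ hα =>
    (h₁ β).2 (hU (add_le_add_right hαβ γ) ((h₁ α).1 hα))
  rw [mem_monoIdeal hU, mem_monoIdeal hU₁]
  constructor
  · intro h α hα
    rw [mem_support_iff, coeff_monomial_mul'] at hα
    split_ifs at hα with hle
    · have := h (α - γ) (by rw [mem_support_iff]; simpa using hα)
      rw [h₁, add_tsub_cancel_of_le hle] at this
      exact this
    · exact absurd rfl hα
  · intro h α hα
    rw [h₁]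
    refine h _ ?_
    rw [mem_support_iff, coeff_monomial_mul, one_mul]
    exact mem_support_iff.1 hα

theorem monoIdeal_sup_span_X {U U₂ : Set (σ →₀ ℕ)} (x : σ)
    (h₂ : ∀ α, α ∈ U₂ ↔ α ∈ U ∨ 0 < α x) :
    monoIdeal K U ⊔ Ideal.span {X x} = monoIdeal K U₂ := by
  refine le_antisymm (sup_le (Ideal.span_mono (Set.image_mono fun α hα => (h₂ α).2 (Or.inl hα))) ?_)
    ?_
  · rw [Ideal.span_singleton_le_iff_mem]
    exact Ideal.subset_span ⟨Finsupp.single x 1, (h₂ _).2 (Or.inr (by simp)), rfl⟩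
  · refine Ideal.span_le.2 ?_
    rintro _ ⟨α, hα, rfl⟩
    rcases (h₂ α).1 hα with h | h
    · exact Ideal.mem_sup_left (Ideal.subset_span ⟨α, h, rfl⟩)
    · refine Ideal.mem_sup_right (Ideal.mem_span_singleton.2 ?_)
      refine ⟨monomial (α - Finsupp.single x 1) 1, ?_⟩
      rw [X, monomial_mul, one_mul, add_tsub_cancel_of_le]
      exact Finsupp.single_le_iff.2 h

variable (K) in
/-- The list `rs` is weakly regular modulo the monomial ideal with exponent set `U`; the condition
is only imposed when `U` is closed under multiples, so that `U` is the exact exponent set. -/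
def IsRegularModMono (U : Set (σ →₀ ℕ)) (rs : List (MvPolynomial σ K)) : Prop :=
  IsUpperSet U → IsWeaklyRegularMod (monoIdeal K U) rs

/-- Splitting a monomial ideal `J` along a variable `x`, into `J : x` and `J + (x)`. -/
theorem IsRegularModMono.pivot {U : Set (σ →₀ ℕ)} {rs : List (MvPolynomial σ K)} (x : σ)
    {U₁ U₂ : Set (σ →₀ ℕ)}
    (hU₁ : ∀ α, α ∈ U₁ ↔ Finsupp.single x 1 + α ∈ U) (h₁ : IsRegularModMono K U₁ rs)
    (hU₂ : ∀ α, α ∈ U₂ ↔ α ∈ U ∨ 0 < α x) (h₂ : IsRegularModMono K U₂ rs) :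
    IsRegularModMono K U rs := by
  intro hU
  refine IsWeaklyRegularMod.of_colon_of_sup (X x) (monomial_mul_mem_monoIdeal hU hU₁)
    (monoIdeal_sup_span_X x hU₂) (h₁ fun α β hαβ hα => ?_) (h₂ fun α β hαβ hα => ?_)
  · exact (hU₁ β).2 (hU (add_le_add_right hαβ _) ((hU₁ α).1 hα))
  · exact (hU₂ β).2 (((hU₂ α).1 hα).imp (fun h => hU hαβ h) fun h => h.trans_le (hαβ x))

/-- Splitting along the variables `x 0, x 1, …` in turn. -/
theorem IsRegularModMono.pivots {n : ℕ} {U : Set (σ →₀ ℕ)} {rs : List (MvPolynomial σ K)}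
    (x : Fin n → σ) (U₁ : Fin n → Set (σ →₀ ℕ)) (U₂ : Set (σ →₀ ℕ))
    (hU₁ : ∀ t α, α ∈ U₁ t ↔ Finsupp.single (x t) 1 + α ∈ U ∨
      ∃ i < t, 0 < (Finsupp.single (x t) 1 + α : σ →₀ ℕ) (x i))
    (h₁ : ∀ t, IsRegularModMono K (U₁ t) rs)
    (hU₂ : ∀ α, α ∈ U₂ ↔ α ∈ U ∨ ∃ i, 0 < α (x i)) (h₂ : IsRegularModMono K U₂ rs) :
    IsRegularModMono K U rs := by
  have key : ∀ k ≤ n,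
      IsRegularModMono K {α | α ∈ U ∨ ∃ i : Fin n, (i : ℕ) < k ∧ 0 < α (x i)} rs := by
    intro k hk
    induction hk using Nat.decreasingInduction with
    | self =>
      convert h₂
      ext α
      simp [hU₂]
    | of_succ k hk ih =>
      refine IsRegularModMono.pivot (x ⟨k, hk⟩) (hU₁ ⟨k, hk⟩) (h₁ _) (fun α => ?_) ih
      simp only [Set.mem_ofPred_eq, Nat.lt_succ_iff_lt_or_eq]
      constructor
      · rintro (h | ⟨i, hi | hi, h⟩)
        · exact Or.inl (Or.inl h)
        · exact Or.inl (Or.inr ⟨i, hi, h⟩)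
        · exact Or.inr (by rwa [← (Fin.ext hi : i = ⟨k, hk⟩)])
      · rintro ((h | ⟨i, hi, h⟩) | h)
        · exact Or.inl h
        · exact Or.inr ⟨i, Or.inl hi, h⟩
        · exact Or.inr ⟨⟨k, hk⟩, Or.inr rfl, h⟩
  simpa using key 0 (Nat.zero_le n)

/-- Coefficient vectors of the linear forms in the variables from `D`. -/
def varSubmodule (K : Type*) [Field K] (D : Set σ) : Submodule K (σ → K) :=
  LinearMap.ker (LinearMap.funLeft K K (Subtype.val : ↥(Dᶜ) → σ))

theorem mem_varSubmodule {D : Set σ} {v : σ → K} :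
    v ∈ varSubmodule K D ↔ ∀ x ∉ D, v x = 0 := by
  rw [varSubmodule, LinearMap.mem_ker, funext_iff]
  simp [LinearMap.funLeft_apply]

theorem finrank_quotient_varSubmodule [Fintype σ] (D : Set σ) :
    Module.finrank K ((σ → K) ⧸ varSubmodule K D) = Nat.card ↥(Dᶜ) := by
  classical
  have e := LinearMap.quotKerEquivOfSurjective _
    (LinearMap.funLeft_surjective_of_injective K K (Subtype.val : ↥(Dᶜ) → σ)
      Subtype.val_injective)
  rw [varSubmodule, e.finrank_eq, Module.finrank_fintype_fun_eq_card, Nat.card_eq_fintype_card]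

theorem monoIdeal_varUpper [Fintype σ] (D : Set σ) :
    monoIdeal K (varUpper D) = linIdeal (varSubmodule K D) := by
  classical
  refine le_antisymm (Ideal.span_le.2 ?_) (Ideal.span_le.2 ?_)
  · rintro _ ⟨α, ⟨x, hx, hα⟩, rfl⟩
    have hX : (X x : MvPolynomial σ K) ∈ linIdeal (varSubmodule K D) := by
      rw [← linForm_single, linForm_mem_linIdeal, mem_varSubmodule]
      exact fun y hy => Pi.single_eq_of_ne (fun h => hy (by rwa [h])) _
    have : monomial α (1 : K) = monomial (α - Finsupp.single x 1) 1 * X x := by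
      rw [X, monomial_mul, one_mul, tsub_add_cancel_of_le]
      exact Finsupp.single_le_iff.2 hα
    change monomial α (1 : K) ∈ _
    rw [this]
    exact Ideal.mul_mem_left _ _ hX
  · rintro _ ⟨v, hv, rfl⟩
    rw [linForm_apply]
    refine Ideal.sum_mem _ fun x _ => ?_
    by_cases hx : x ∈ D
    · rw [smul_eq_C_mul]
      refine Ideal.mul_mem_left _ _ (Ideal.subset_span ⟨Finsupp.single x 1, ⟨x, hx, ?_⟩, rfl⟩)
      simp
    · rw [mem_varSubmodule.1 hv x hx, zero_smul]
      exact Ideal.zero_mem _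

/-- The linear forms `∑ x, c x i • X x`, `i : ι`, given by the rows `c x : ι → K` of a matrix. -/
def formList {ι : Type*} [Fintype σ] [Fintype ι] (c : σ → ι → K) : List (MvPolynomial σ K) :=
  Finset.univ.toList.map fun i => linForm fun x => c x i

/-- The forms given by the matrix `c` are weakly regular modulo the variables in `D` as soon as the
rows of `c` outside `D` have full rank. -/
theorem isRegularModMono_varUpper {ι : Type*} [Fintype σ] [Fintype ι] {c : σ → ι → K}
    {U : Set (σ →₀ ℕ)} (D : Set σ) (hU : ∀ α, α ∈ U ↔ ∃ x ∈ D, 0 < α x)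
    (h : ∀ t : ι → K, (∀ x ∉ D, c x ⬝ᵥ t = 0) → t = 0) :
    IsRegularModMono K U (formList c) := by
  intro _
  obtain rfl : U = varUpper D := Set.ext hU
  rw [monoIdeal_varUpper]
  refine isWeaklyRegularMod_linIdeal _ _ (Finset.nodup_toList _) _ fun t _ ht => h t fun x hx => ?_
  have := mem_varSubmodule.1 ht x hx
  simpa [dotProduct, Finset.sum_apply, mul_comm] using this

end Monomial

/-! ### Depth and dimension of monomial quotients -/

section DepthMono

variable {σ K : Type*} [Fintype σ] [Field K]

theorem span_range_X_eq_linIdeal :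
    Ideal.span (Set.range (X : σ → MvPolynomial σ K)) = linIdeal ⊤ := by
  refine le_antisymm (Ideal.span_le.2 ?_) (Ideal.span_le.2 ?_)
  · classical
    rintro _ ⟨x, rfl⟩
    exact Ideal.subset_span ⟨Pi.single x 1, trivial, linForm_single x⟩
  · rintro _ ⟨v, -, rfl⟩
    rw [linForm_apply]
    refine Ideal.sum_mem _ fun x _ => ?_
    rw [smul_eq_C_mul]
    exact Ideal.mul_mem_left _ _ (Ideal.subset_span ⟨x, rfl⟩)

theorem linIdeal_mono {W W' : Submodule K (σ → K)} (h : W ≤ W') : linIdeal W ≤ linIdeal W' :=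
  Ideal.span_mono (Set.image_mono h)

theorem monoIdeal_le_linIdeal_top {U : Set (σ →₀ ℕ)} (h0 : (0 : σ →₀ ℕ) ∉ U) :
    monoIdeal K U ≤ linIdeal ⊤ := by
  have h : (⊤ : Submodule K (σ → K)) = varSubmodule K Set.univ := by
    ext v
    simp [mem_varSubmodule]
  rw [h, ← monoIdeal_varUpper]
  refine Ideal.span_mono (Set.image_mono fun α hα => ?_)
  by_contra hcon
  refine h0 ?_
  have : α = 0 := Finsupp.ext fun x => by
    by_contra hx
    exact hcon ⟨x, trivial, Nat.pos_of_ne_zero hx⟩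
  rwa [← this]

/-- The depth of a monomial quotient: a weakly regular family of linear forms bounds it from below,
an associated prime `(D) = J : x^γ` generated by variables from above. -/
theorem depthQuotient_monoIdeal {ι : Type*} [Fintype ι] {c : σ → ι → K} {U : Set (σ →₀ ℕ)}
    (hU : IsUpperSet U) (hreg : IsRegularModMono K U (formList c)) {D : Set σ} {γ : σ →₀ ℕ}
    (hγ : ∀ α, γ + α ∈ U ↔ α ∈ varUpper D) (hcard : Nat.card ↥(Dᶜ) = Fintype.card ι) :
    depthQuotient (monoIdeal K U) = Fintype.card ι := by
  have hP : IsAssociatedPrime (linIdeal (varSubmodule K D)) (MvPolynomial σ K ⧸ monoIdeal K U) := by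
    refine isAssociatedPrime_iff.2 ⟨linIdeal_isPrime _,
      Ideal.Quotient.mk (monoIdeal K U) (monomial γ 1), ?_⟩
    ext f
    rw [Submodule.mem_colon_singleton, Submodule.mem_bot, ← Ideal.Quotient.mk_eq_mk,
      ← Submodule.Quotient.mk_smul, Submodule.Quotient.mk_eq_zero, smul_eq_mul, mul_comm,
      ← monoIdeal_varUpper]
    exact monomial_mul_mem_monoIdeal hU (fun α => (hγ α).symm) f
  have h0 : (0 : σ →₀ ℕ) ∉ U := fun h => by
    have := (hγ 0).1 (hU (by simp) h)
    obtain ⟨x, -, hx⟩ := this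
    simp at hx
  have := linIdeal_isPrime (⊤ : Submodule K (σ → K))
  rw [depthQuotient, depthIn, span_range_X_eq_linIdeal]
  refine le_antisymm (iSup_le ?_) ?_
  · rintro ⟨rs, hrs, hmem⟩
    have h1 := length_le_ringKrullDim_of_isAssociatedPrime hrs.toIsWeaklyRegular hmem hP
      (linIdeal_mono le_top)
    rw [ringKrullDim_quotient_linIdeal, finrank_quotient_varSubmodule, hcard] at h1
    exact_mod_cast h1
  · have hmem : ∀ f ∈ formList c, f ∈ linIdeal (⊤ : Submodule K (σ → K)) := by
      intro f hf
      obtain ⟨i, -, rfl⟩ := List.mem_map.1 hf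
      exact Ideal.subset_span ⟨_, trivial, rfl⟩
    have hregular : RingTheory.Sequence.IsRegular (MvPolynomial σ K ⧸ monoIdeal K U)
        (formList c) := by
      refine ⟨(hreg hU).isWeaklyRegular, fun htop => ?_⟩
      have h1 : (Submodule.mkQ (monoIdeal K U)) 1 ∈
          (linIdeal (⊤ : Submodule K (σ → K))) •
            (⊤ : Submodule (MvPolynomial σ K) (MvPolynomial σ K ⧸ monoIdeal K U)) :=
        Submodule.smul_mono_left (Ideal.span_le.2 hmem) (htop ▸ Submodule.mem_top)
      have h2 : (linIdeal (⊤ : Submodule K (σ → K))) •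
            (⊤ : Submodule (MvPolynomial σ K) (MvPolynomial σ K ⧸ monoIdeal K U)) ≤
          Submodule.map (Submodule.mkQ (monoIdeal K U)) (linIdeal (⊤ : Submodule K (σ → K))) := by
        refine Submodule.smul_le.2 fun r hr n _ => ?_
        obtain ⟨f, rfl⟩ := Submodule.mkQ_surjective _ n
        exact ⟨r • f, Ideal.mul_mem_right _ _ hr, by rw [map_smul]⟩
      obtain ⟨f, hf, hf1⟩ := h2 h1
      have h3 : f - 1 ∈ monoIdeal K U := (Submodule.Quotient.eq _).1 hf1
      refine this.ne_top ((Ideal.eq_top_iff_one _).2 ?_)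
      have h4 := Ideal.sub_mem _ hf (monoIdeal_le_linIdeal_top h0 h3)
      simpa using h4
    have hlen : ((formList c).length : ℕ∞) = Fintype.card ι := by simp [formList]
    rw [← hlen]
    exact le_iSup (fun rs : {rs : List (MvPolynomial σ K) // RingTheory.Sequence.IsRegular
      (MvPolynomial σ K ⧸ monoIdeal K U) rs ∧ ∀ r ∈ rs, r ∈ linIdeal (⊤ : Submodule K (σ → K))} =>
        (rs.1.length : ℕ∞)) ⟨formList c, hregular, hmem⟩

/-- A monomial quotient has dimension `N` if every prime containing the monomial ideal contains
variables from a set `D` with complement of size at most `N`, with equality for some `D`. -/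
theorem ringKrullDim_monoIdeal {U : Set (σ →₀ ℕ)} {N : ℕ}
    (hle : ∀ P : Ideal (MvPolynomial σ K), P.IsPrime → monoIdeal K U ≤ P →
      ∃ D : Set σ, (∀ x ∈ D, X x ∈ P) ∧ Nat.card ↥(Dᶜ) ≤ N)
    {D₀ : Set σ} (hD₀ : U ⊆ varUpper D₀) (hcard : Nat.card ↥(D₀ᶜ) = N) :
    ringKrullDim (MvPolynomial σ K ⧸ monoIdeal K U) = N := by
  refine le_antisymm ?_ ?_
  · rw [ringKrullDim_quotient]
    refine iSup_le fun p => ?_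
    obtain ⟨D, hD, hDN⟩ := hle p.head.1.asIdeal p.head.1.isPrime p.head.2
    have h1 : linIdeal (varSubmodule K D) ≤ p.head.1.asIdeal := by
      refine Ideal.span_le.2 ?_
      rintro _ ⟨v, hv, rfl⟩
      rw [linForm_apply]
      refine Ideal.sum_mem _ fun x _ => ?_
      by_cases hx : x ∈ D
      · rw [smul_eq_C_mul]
        exact Ideal.mul_mem_left _ _ (hD x hx)
      · rw [mem_varSubmodule.1 hv x hx, zero_smul]
        exact Ideal.zero_mem _
    have h2 : (p.length : ℕ∞) ≤ Order.coheight p.head.1 :=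
      Order.length_le_coheight (p := p.map Subtype.val fun _ _ h => h) le_rfl
    have h3 : Order.coheight p.head.1 ≤
        Order.coheight (⟨_, linIdeal_isPrime (varSubmodule K D)⟩ : PrimeSpectrum _) :=
      Order.coheight_anti h1
    have h4 := (WithBot.coe_le_coe.2 (h2.trans h3)).trans
      (coheight_eq_ringKrullDim_quotient _).le
    rw [ringKrullDim_quotient_linIdeal, finrank_quotient_varSubmodule] at h4
    exact h4.trans (by exact_mod_cast hDN)
  · have h : monoIdeal K U ≤ monoIdeal K (varUpper D₀) := Ideal.span_mono (Set.image_mono hD₀)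
    refine le_trans ?_ (ringKrullDim_le_of_surjective (Ideal.Quotient.factor h)
      (Ideal.Quotient.factor_surjective h))
    rw [monoIdeal_varUpper, ringKrullDim_quotient_linIdeal, finrank_quotient_varSubmodule, hcard]

end DepthMono

/-! ### Initial ideals of toric ideals -/

section Initial

variable {σ τ K : Type*} [Field K]

/-- The exponent of the image of `x^α` under the monomial map `x_i ↦ t^(A i)`. -/
def toricDegree (A : σ → τ →₀ ℕ) : (σ →₀ ℕ) →+ (τ →₀ ℕ) :=
  (Finsupp.linearCombination ℕ A).toAddMonoidHom

theorem toricDegree_apply [Fintype σ] (A : σ → τ →₀ ℕ) (α : σ →₀ ℕ) :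
    toricDegree A α = ∑ x, α x • A x := by
  simp [toricDegree, Finsupp.linearCombination_apply, Finsupp.sum_fintype]

theorem aeval_monomial_toric (A : σ → τ →₀ ℕ) (α : σ →₀ ℕ) (c : K) :
    aeval (fun i => monomial (A i) (1 : K)) (monomial α c) = monomial (toricDegree A α) c := by
  rw [aeval_monomial, Finsupp.prod, MvPolynomial.algebraMap_eq]
  simp only [monomial_pow, one_pow]
  rw [toricDegree, LinearMap.toAddMonoidHom_coe, Finsupp.linearCombination_apply, Finsupp.sum,
    monomial_sum_index]

open Classical in
theorem coeff_aeval_toric (A : σ → τ →₀ ℕ) (f : MvPolynomial σ K) (γ : τ →₀ ℕ) :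
    coeff γ (aeval (fun i => monomial (A i) (1 : K)) f) =
      ∑ α ∈ f.support with toricDegree A α = γ, coeff α f := by
  conv_lhs => rw [f.as_sum, map_sum, coeff_sum]
  rw [Finset.sum_filter]
  refine Finset.sum_congr rfl fun α _ => ?_
  rw [aeval_monomial_toric, coeff_monomial]

/-- The initial ideal of a toric ideal is spanned by the monomials that are not the smallest of
their fibre. -/
theorem initialIdeal_ker_toric (m : MonomialOrder σ) (A : σ → τ →₀ ℕ) :
    initialIdeal m (RingHom.ker (aeval (fun i => monomial (A i) (1 : K)) :
      MvPolynomial σ K →ₐ[K] MvPolynomial τ K)) =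
      monoIdeal K {α | ∃ β, β ≺[m] α ∧ toricDegree A β = toricDegree A α} := by
  classical
  refine le_antisymm (Ideal.span_le.2 ?_) (Ideal.span_le.2 ?_)
  · rintro _ ⟨f, hf, rfl⟩
    by_cases hf0 : f = 0
    · rw [hf0, MonomialOrder.leadingTerm_zero]
      exact Ideal.zero_mem _
    have hdeg : ∃ β, β ≺[m] m.degree f ∧ toricDegree A β = toricDegree A (m.degree f) := by
      by_contra! hcon
      have h0 : coeff (toricDegree A (m.degree f))
          (aeval (fun i => monomial (A i) (1 : K)) f) = 0 := by
        rw [(RingHom.mem_ker).1 hf, coeff_zero]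
      rw [coeff_aeval_toric, Finset.sum_eq_single (m.degree f)] at h0
      · exact hf0 (m.leadingCoeff_eq_zero_iff.1 h0)
      · intro β hβ hne
        rw [Finset.mem_filter] at hβ
        refine absurd hβ.2 (hcon β (lt_of_le_of_ne (m.le_degree hβ.1) fun h => hne ?_))
        exact m.toSyn.injective h
      · intro h
        rw [Finset.mem_filter, not_and] at h
        by_contra hne
        exact h (mem_support_iff.2 hne) rfl
    rw [MonomialOrder.leadingTerm, SetLike.mem_coe, ← mul_one (m.leadingCoeff f),
      ← C_mul_monomial]
    exact Ideal.mul_mem_left _ _ (Ideal.subset_span ⟨_, hdeg, rfl⟩)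
  · rintro _ ⟨α, ⟨β, hβ, h⟩, rfl⟩
    refine Ideal.subset_span ⟨monomial α 1 - monomial β 1, ?_, ?_⟩
    · rw [SetLike.mem_coe, RingHom.mem_ker, map_sub]
      rw [aeval_monomial_toric, aeval_monomial_toric, h, sub_self]
    · have hlt : m.degree (monomial β (1 : K)) ≺[m] m.degree (monomial α (1 : K)) := by
        rwa [m.degree_monomial, m.degree_monomial, if_neg one_ne_zero, if_neg one_ne_zero]
      rw [MonomialOrder.leadingTerm, m.degree_sub_of_lt hlt, m.leadingCoeff_sub_of_lt hlt,
        m.leadingCoeff_monomial, m.degree_monomial, if_neg one_ne_zero]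

/-- If every monomial of `U` can be made smaller within its fibre, and every fibre contains at most
one monomial outside `U`, then `U` is the set of non-minimal monomials of the fibres. Here `U` is
written in variables `ρ`, matched with the variables `σ` by `e`. -/
theorem nonminimal_eq {ρ δ : Type*} (m : MonomialOrder σ) (e : ρ ≃ σ) (F : (σ →₀ ℕ) → δ)
    (U : Set (ρ →₀ ℕ))
    (h₁ : ∀ α ∈ U, ∃ β : ρ →₀ ℕ, β.equivMapDomain e ≺[m] α.equivMapDomain e ∧
      F (β.equivMapDomain e) = F (α.equivMapDomain e))
    (h₂ : ∀ α β : ρ →₀ ℕ, α ∉ U → β ∉ U → F (α.equivMapDomain e) = F (β.equivMapDomain e) → α = β) :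
    {α | ∃ β, β ≺[m] α ∧ F β = F α} = Finsupp.equivMapDomain e '' U := by
  have hsurj : ∀ α : σ →₀ ℕ, ∃ α' : ρ →₀ ℕ, α'.equivMapDomain e = α :=
    fun α => ⟨α.equivMapDomain e.symm, by ext; simp⟩
  ext α
  constructor
  · rintro ⟨β, hβ, hF⟩
    obtain ⟨α, rfl⟩ := hsurj α
    refine ⟨α, ?_, rfl⟩
    by_contra hα
    let S : Set m.syn := {x | ∃ γ : ρ →₀ ℕ, x = m.toSyn (γ.equivMapDomain e) ∧
      F (γ.equivMapDomain e) = F (α.equivMapDomain e)}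
    have hS : S.Nonempty := by
      obtain ⟨β, rfl⟩ := hsurj β
      exact ⟨_, β, rfl, hF⟩
    obtain ⟨γ, hγ, hγF⟩ := WellFounded.min_mem (wellFounded_lt (α := m.syn)) S hS
    have hmin : ∀ γ' : ρ →₀ ℕ, F (γ'.equivMapDomain e) = F (α.equivMapDomain e) →
        ¬ γ'.equivMapDomain e ≺[m] γ.equivMapDomain e := fun γ' h' => by
      rw [← hγ]
      exact WellFounded.not_lt_min (wellFounded_lt (α := m.syn)) S ⟨γ', rfl, h'⟩
    have hγU : γ ∉ U := fun h => by
      obtain ⟨γ', h1, h2⟩ := h₁ γ h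
      exact hmin γ' (h2.trans hγF) h1
    obtain rfl := h₂ γ α hγU hα hγF
    obtain ⟨β, rfl⟩ := hsurj β
    exact hmin β hF hβ
  · rintro ⟨α, hα, rfl⟩
    obtain ⟨β, hβ⟩ := h₁ α hα
    exact ⟨_, hβ⟩

end Initial

/-! ### Lexicographic and reverse lexicographic orders -/

section Orders

variable {σ : Type*} {n : ℕ}

/-- The lexicographic order with `x 0 > x 1 > ⋯`. -/
def lexOrder (x : Fin n ≃ σ) : MonomialOrder σ where
  syn := (MonomialOrder.lex (σ := Fin n)).syn
  toSyn := (Finsupp.domCongr x.symm).trans (MonomialOrder.lex (σ := Fin n)).toSyn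
  toSyn_monotone := fun a b h => (MonomialOrder.lex (σ := Fin n)).toSyn_monotone
    (show Finsupp.domCongr x.symm a ≤ Finsupp.domCongr x.symm b from fun i => by
      simpa using h (x i))

theorem lexOrder_lt_iff (x : Fin n ≃ σ) (a b : σ →₀ ℕ) :
    a ≺[lexOrder x] b ↔
      ∃ i : Fin n, a (x i) < b (x i) ∧ ∀ j : Fin n, j < i → a (x j) = b (x j) := by
  change toLex (Finsupp.domCongr x.symm a) < toLex (Finsupp.domCongr x.symm b) ↔ _
  rw [Finsupp.Lex.lt_iff]
  simp [and_comm]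

/-- A copy of `σ →₀ ℕ`, to carry the graded reverse lexicographic order of an ordering of `σ`. -/
def RevLexSyn (_ : Fin n ≃ σ) : Type _ := σ →₀ ℕ

instance (x : Fin n ≃ σ) : AddCommMonoid (RevLexSyn x) := inferInstanceAs (AddCommMonoid (σ →₀ ℕ))

/-- The degree, followed by the exponents read backwards from the last variable, which are compared
in the opposite order. -/
def revLexKey (x : Fin n ≃ σ) (a : σ →₀ ℕ) : ℕ ×ₗ Lex (Fin n → ℕᵒᵈ) :=
  toLex (a.degree, toLex fun i => OrderDual.toDual (a (x i.rev)))

theorem revLexKey_injective (x : Fin n ≃ σ) : Function.Injective (revLexKey x) := by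
  intro a b h
  ext y
  have h1 : (toLex fun i => OrderDual.toDual (a (x i.rev)) : Lex (Fin n → ℕᵒᵈ)) =
      toLex fun i => OrderDual.toDual (b (x i.rev)) := (Prod.ext_iff.1 (toLex.injective h)).2
  have := congrFun (toLex.injective h1) (x.symm y).rev
  simpa using this

theorem revLexKey_lt_iff (x : Fin n ≃ σ) (a b : σ →₀ ℕ) :
    revLexKey x a < revLexKey x b ↔ a.degree < b.degree ∨ (a.degree = b.degree ∧
      ∃ i : Fin n, b (x i) < a (x i) ∧ ∀ j : Fin n, i < j → a (x j) = b (x j)) := by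
  rw [revLexKey, revLexKey, Prod.Lex.toLex_lt_toLex]
  refine or_congr_right (and_congr_right fun _ => ?_)
  change (∃ i : Fin n,
    (∀ j, j < i → OrderDual.toDual (a (x j.rev)) = OrderDual.toDual (b (x j.rev))) ∧
    OrderDual.toDual (a (x i.rev)) < OrderDual.toDual (b (x i.rev))) ↔ _
  constructor
  · rintro ⟨i, hi, h⟩
    refine ⟨i.rev, h, fun j hj => ?_⟩
    have := hi j.rev (Fin.rev_lt_iff.2 hj)
    simpa using this
  · rintro ⟨i, h, hi⟩
    refine ⟨i.rev, fun j hj => ?_, by simpa using h⟩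
    exact congrArg OrderDual.toDual (hi j.rev (Fin.lt_rev_iff.2 hj))

instance (x : Fin n ≃ σ) : LinearOrder (RevLexSyn x) :=
  LinearOrder.lift' (revLexKey x) (revLexKey_injective x)

theorem revLexSyn_lt_iff (x : Fin n ≃ σ) (a b : RevLexSyn x) :
    a < b ↔ revLexKey x a < revLexKey x b := Iff.rfl

theorem revLexSyn_monotone (x : Fin n ≃ σ) {a b : σ →₀ ℕ} (h : a ≤ b) :
    (show RevLexSyn x from a) ≤ (show RevLexSyn x from b) := by
  rcases h.eq_or_lt with rfl | h
  · exact le_rfl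
  · refine le_of_lt ((revLexKey_lt_iff x a b).2 (Or.inl ?_))
    obtain ⟨c, rfl⟩ := le_iff_exists_add.1 h.le
    have hc : c ≠ 0 := fun hc => by simp [hc] at h
    have := (Finsupp.degree_eq_zero_iff c).not.2 hc
    rw [map_add]
    omega

instance (x : Fin n ≃ σ) : IsOrderedAddMonoid (RevLexSyn x) where
  add_le_add_left a b h c := by
    rcases h.eq_or_lt with rfl | h
    · exact le_rfl
    · refine le_of_lt ?_
      rw [revLexSyn_lt_iff] at h ⊢
      erw [revLexKey_lt_iff] at h ⊢
      erw [map_add, map_add]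
      refine h.imp (fun h => by simpa using h) fun ⟨h, i, h1, h2⟩ => ⟨by simp [h], i, ?_, ?_⟩
      · erw [Finsupp.add_apply, Finsupp.add_apply]
        simpa using h1
      · intro j hj
        erw [Finsupp.add_apply, Finsupp.add_apply]
        rw [h2 j hj]

instance (x : Fin n ≃ σ) : WellFoundedLT (RevLexSyn x) := by
  have : Finite σ := Finite.of_equiv _ x
  have h : Monotone fun a : σ →₀ ℕ => (show RevLexSyn x from a) := fun _ _ => revLexSyn_monotone x
  exact wellQuasiOrderedLE_iff_wellFoundedLT.1
    (h.wellQuasiOrderedLE_of_wellQuasiOrderedLE_of_surjective fun a => ⟨a, rfl⟩)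

/-- The graded reverse lexicographic order with `x 0 > x 1 > ⋯`. -/
def revLexOrder (x : Fin n ≃ σ) : MonomialOrder σ where
  syn := RevLexSyn x
  toSyn := { Equiv.refl (σ →₀ ℕ) with map_add' := fun _ _ => rfl }
  toSyn_monotone := fun _ _ h => revLexSyn_monotone x h

theorem revLexOrder_lt_iff (x : Fin n ≃ σ) (a b : σ →₀ ℕ) :
    a ≺[revLexOrder x] b ↔ a.degree < b.degree ∨ (a.degree = b.degree ∧
      ∃ i : Fin n, b (x i) < a (x i) ∧ ∀ j : Fin n, i < j → a (x j) = b (x j)) :=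
  revLexKey_lt_iff x a b

end Orders

/-! ### Change of variables -/

section Transport

theorem depthIn_le_of_ringEquiv {R S : Type*} [CommRing R] [CommRing S] (Φ : R ≃+* S)
    {I J : Ideal R} {I' J' : Ideal S} (hI : ∀ x ∈ I, Φ x ∈ I') (hJ : J' = J.map (Φ : R →+* S)) :
    depthIn I (R ⧸ J) ≤ depthIn I' (S ⧸ J') := by
  refine iSup_le ?_
  rintro ⟨rs, hrs, hmem⟩
  let e : (R ⧸ J) ≃+ (S ⧸ J') := (Ideal.quotientEquiv J J' Φ hJ).toAddEquiv
  have h : RingTheory.Sequence.IsRegular (S ⧸ J') (rs.map Φ) := by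
    refine (AddEquiv.isRegular_congr (e := e) ?_).1 hrs
    rw [List.forall₂_map_right_iff, List.forall₂_same]
    intro r _ y
    obtain ⟨f, rfl⟩ := Ideal.Quotient.mk_surjective y
    change Ideal.quotientEquiv J J' Φ hJ (Ideal.Quotient.mk J (r * f)) =
      Ideal.Quotient.mk J' (Φ r) * Ideal.quotientEquiv J J' Φ hJ (Ideal.Quotient.mk J f)
    rw [Ideal.quotientEquiv_mk, Ideal.quotientEquiv_mk, map_mul, map_mul]
  have hlen : rs.length = (rs.map Φ).length := by simp
  change (rs.length : ℕ∞) ≤ _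
  rw [hlen]
  refine le_iSup (fun rs : {rs : List S // RingTheory.Sequence.IsRegular
      (S ⧸ J') rs ∧ ∀ r ∈ rs, r ∈ I'} => (rs.1.length : ℕ∞)) ⟨rs.map Φ, h, ?_⟩
  intro r hr
  obtain ⟨r', hr', rfl⟩ := List.mem_map.1 hr
  exact hI r' (hmem r' hr')

universe u

variable {σ ρ : Type u} {K : Type*} [Field K]

theorem monoIdeal_map_renameEquiv (e : ρ ≃ σ) (U : Set (ρ →₀ ℕ)) :
    monoIdeal K (Finsupp.equivMapDomain e '' U) =
      (monoIdeal K U).map ((renameEquiv K e).toRingEquiv : MvPolynomial ρ K →+* _) := by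
  rw [monoIdeal, monoIdeal, Ideal.map_span, Set.image_image, Set.image_image]
  congr 1
  refine Set.image_congr fun α _ => ?_
  simp [rename_monomial, Finsupp.equivMapDomain_eq_mapDomain]

theorem depthQuotient_monoIdeal_equiv (e : ρ ≃ σ) (U : Set (ρ →₀ ℕ)) :
    depthQuotient (monoIdeal K (Finsupp.equivMapDomain e '' U)) =
      depthQuotient (monoIdeal K U) := by
  have key : ∀ {σ ρ : Type u} (e : ρ ≃ σ) (U : Set (ρ →₀ ℕ)),
      depthQuotient (monoIdeal K U) ≤
        depthQuotient (monoIdeal K (Finsupp.equivMapDomain e '' U)) := by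
    intro σ ρ e U
    refine depthIn_le_of_ringEquiv (renameEquiv K e).toRingEquiv (fun f hf => ?_)
      (monoIdeal_map_renameEquiv e U)
    have h : Ideal.span (Set.range (X : ρ → MvPolynomial ρ K)) ≤
        (Ideal.span (Set.range (X : σ → MvPolynomial σ K))).comap
          ((renameEquiv K e).toRingEquiv : MvPolynomial ρ K →+* _) := by
      refine Ideal.span_le.2 ?_
      rintro _ ⟨x, rfl⟩
      exact Ideal.subset_span ⟨e x, by simp⟩
    exact h hf
  refine le_antisymm ?_ (key e U)
  refine (key e.symm _).trans (le_of_eq ?_)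
  rw [Set.image_image]
  congr
  refine (Set.image_congr fun α _ => ?_).trans (Set.image_id U)
  ext
  simp

theorem ringKrullDim_monoIdeal_equiv (e : ρ ≃ σ) (U : Set (ρ →₀ ℕ)) :
    ringKrullDim (MvPolynomial σ K ⧸ monoIdeal K (Finsupp.equivMapDomain e '' U)) =
      ringKrullDim (MvPolynomial ρ K ⧸ monoIdeal K U) :=
  (ringKrullDim_eq_of_ringEquiv (Ideal.quotientEquiv _ _ (renameEquiv K e).toRingEquiv
    (monoIdeal_map_renameEquiv e U))).symm

end Transport

/-! ### The edges of the graph -/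

/-- Names for the edges of the graph with parameters `k = m + 1` and `l` pendant edges. One triangle
has the edges `p = {1, 3}`, `q = {1, k+4}`, `r = {3, k+4}`, the other one `u = {2, 4}`,
`v = {2, k+5}`, `w = {4, k+5}`; they are joined by the edge `s = {3, 4}` and by the paths
`a j = {1, j+5}`, `b j = {2, j+5}`; the pendant edges are `z i`. -/
inductive EdgeVar (m l : ℕ) : Type
  | p | q | r | s | u | v | w
  | a (j : Fin m)
  | b (j : Fin m)
  | z (i : Fin l)
  deriving DecidableEq

namespace EdgeVar

variable {m l : ℕ}

/-- The edge names as a disjoint union. -/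
def equivSum : EdgeVar m l ≃ Fin 7 ⊕ Fin m ⊕ Fin m ⊕ Fin l where
  toFun
    | p => .inl 0
    | q => .inl 1
    | r => .inl 2
    | s => .inl 3
    | u => .inl 4
    | v => .inl 5
    | w => .inl 6
    | a j => .inr (.inl j)
    | b j => .inr (.inr (.inl j))
    | z i => .inr (.inr (.inr i))
  invFun
    | .inl i => ![p, q, r, s, u, v, w] i
    | .inr (.inl j) => a j
    | .inr (.inr (.inl j)) => b j
    | .inr (.inr (.inr i)) => z i
  left_inv x := by cases x <;> rfl
  right_inv x := by
    rcases x with i | j | j | i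
    · fin_cases i <;> rfl
    all_goals rfl

instance : Fintype (EdgeVar m l) := Fintype.ofEquiv _ equivSum.symm

theorem card_eq : Fintype.card (EdgeVar m l) = 7 + 2 * m + l := by
  rw [Fintype.card_congr equivSum]
  simp
  omega

theorem sum_eq {M : Type*} [AddCommMonoid M] (f : EdgeVar m l → M) :
    ∑ x, f x = f p + f q + f r + f s + f u + f v + f w +
      (∑ j, f (a j) + (∑ j, f (b j) + ∑ i, f (z i))) := by
  rw [← equivSum.symm.sum_comp, Fintype.sum_sum_type, Fintype.sum_sum_type, Fintype.sum_sum_type]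
  congr 1
  simp [Fin.sum_univ_succ, equivSum, add_assoc]

/-- The smaller endpoint of an edge, as an element of `Fin d`. -/
def src : EdgeVar m l → Fin (l + 6 + m)
  | p | q | a _ | z _ => ⟨0, by omega⟩
  | u | v | b _ => ⟨1, by omega⟩
  | r | s => ⟨2, by omega⟩
  | w => ⟨3, by omega⟩

/-- The larger endpoint of an edge, as an element of `Fin d`. -/
def tgt : EdgeVar m l → Fin (l + 6 + m)
  | p => ⟨2, by omega⟩
  | s | u => ⟨3, by omega⟩
  | q | r => ⟨m + 4, by omega⟩
  | v | w => ⟨m + 5, by omega⟩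
  | a j | b j => ⟨4 + j, by omega⟩
  | z i => ⟨m + 6 + i, by omega⟩

theorem src_lt_tgt (x : EdgeVar m l) : src x < tgt x := by
  cases x <;> simp only [src, tgt, Fin.mk_lt_mk] <;> omega

theorem ends_injective {x y : EdgeVar m l} (h₁ : src x = src y) (h₂ : tgt x = tgt y) : x = y := by
  cases x <;> cases y <;> simp only [src, tgt, Fin.mk.injEq, reduceCtorEq, a.injEq, b.injEq,
    z.injEq] at h₁ h₂ ⊢ <;> omega

theorem rel_iff (i j : Fin (l + 6 + m)) :
    (CoreEdge (m + 1) ((i : ℕ) + 1) ((j : ℕ) + 1) ∨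
      ((i : ℕ) + 1 = 1 ∧ m + 1 + 5 < (j : ℕ) + 1)) ↔ ∃ x : EdgeVar m l, src x = i ∧ tgt x = j := by
  obtain ⟨i, hi⟩ := i
  obtain ⟨j, hj⟩ := j
  constructor
  · intro h
    simp only [CoreEdge] at h
    rcases h with (⟨h1, h2 | h2 | h2⟩ | ⟨h1, h2 | h2 | h2⟩ | ⟨h1, h2 | h2⟩ | ⟨h1, h2⟩) | ⟨h1, h2⟩
    · exact ⟨p, Fin.ext (by simp [src]; omega), Fin.ext (by simp [tgt]; omega)⟩
    · exact ⟨a ⟨j - 4, by omega⟩, Fin.ext (by simp [src]; omega), Fin.ext (by simp [tgt]; omega)⟩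
    · exact ⟨q, Fin.ext (by simp [src]; omega), Fin.ext (by simp [tgt]; omega)⟩
    · exact ⟨u, Fin.ext (by simp [src]; omega), Fin.ext (by simp [tgt]; omega)⟩
    · exact ⟨b ⟨j - 4, by omega⟩, Fin.ext (by simp [src]; omega), Fin.ext (by simp [tgt]; omega)⟩
    · exact ⟨v, Fin.ext (by simp [src]; omega), Fin.ext (by simp [tgt]; omega)⟩
    · exact ⟨s, Fin.ext (by simp [src]; omega), Fin.ext (by simp [tgt]; omega)⟩
    · exact ⟨r, Fin.ext (by simp [src]; omega), Fin.ext (by simp [tgt]; omega)⟩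
    · exact ⟨w, Fin.ext (by simp [src]; omega), Fin.ext (by simp [tgt]; omega)⟩
    · exact ⟨z ⟨j - (m + 6), by omega⟩, Fin.ext (by simp [src]; omega),
        Fin.ext (by simp [tgt]; omega)⟩
  · rintro ⟨x, h1, h2⟩
    cases x <;> simp only [src, tgt, Fin.mk.injEq] at h1 h2 <;> simp only [CoreEdge] <;> omega

theorem adj_iff (i j : Fin (l + 6 + m)) :
    (pendantGraph (m + 1) (l + 6 + m)).Adj i j ↔
      ∃ x : EdgeVar m l, s(src x, tgt x) = s(i, j) := by
  rw [pendantGraph, SimpleGraph.fromRel_adj]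
  simp only [rel_iff, Sym2.eq_iff]
  constructor
  · rintro ⟨-, ⟨x, hx⟩ | ⟨x, hx⟩⟩
    · exact ⟨x, Or.inl hx⟩
    · exact ⟨x, Or.inr hx⟩
  · rintro ⟨x, ⟨rfl, rfl⟩ | ⟨rfl, rfl⟩⟩
    · exact ⟨(src_lt_tgt x).ne, Or.inl ⟨x, rfl, rfl⟩⟩
    · exact ⟨(src_lt_tgt x).ne', Or.inr ⟨x, rfl, rfl⟩⟩

theorem adj_ends (x : EdgeVar m l) :
    (pendantGraph (m + 1) (l + 6 + m)).Adj (src x) (tgt x) := (adj_iff _ _).2 ⟨x, rfl⟩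

/-- The edge names label the edges of the graph. -/
def edgeEquiv (m l : ℕ) : EdgeVar m l ≃ (pendantGraph (m + 1) (l + 6 + m)).edgeSet :=
  Equiv.ofBijective (fun x => ⟨s(src x, tgt x), adj_ends x⟩) (by
    constructor
    · intro x y h
      rcases Sym2.eq_iff.1 (congrArg Subtype.val h) with ⟨h1, h2⟩ | ⟨h1, h2⟩
      · exact ends_injective h1 h2
      · have h3 := src_lt_tgt x
        have h4 := src_lt_tgt y
        rw [h1, h2] at h3
        exact absurd h3 h4.not_gt
    · rintro ⟨e, he⟩
      induction e using Sym2.inductionOn with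
      | hf i j =>
        obtain ⟨x, hx⟩ := (adj_iff i j).1 he
        exact ⟨x, Subtype.ext hx⟩)

theorem connected : (pendantGraph (m + 1) (l + 6 + m)).Connected := by
  have hr : ∀ i, (pendantGraph (m + 1) (l + 6 + m)).Reachable ⟨0, by omega⟩ i := by
    have hsrc : ∀ x : EdgeVar m l, (pendantGraph (m + 1) (l + 6 + m)).Reachable (src x) (tgt x) :=
      fun x => (adj_ends x).reachable
    have h2 : (pendantGraph (m + 1) (l + 6 + m)).Reachable ⟨0, by omega⟩ ⟨2, by omega⟩ := hsrc p
    have h3 := h2.trans (hsrc (s : EdgeVar m l))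
    have h1 := h3.trans (hsrc (u : EdgeVar m l)).symm
    rintro ⟨i, hi⟩
    rcases (by omega : i = 0 ∨ i = 1 ∨ i = 2 ∨ i = 3 ∨ (4 ≤ i ∧ i < m + 4) ∨ i = m + 4 ∨
      i = m + 5 ∨ m + 6 ≤ i) with h | h | h | h | h | h | h | h
    · subst h; exact SimpleGraph.Reachable.refl _
    · subst h; exact h1
    · subst h; exact h2
    · subst h; exact h3
    · have := hsrc (a ⟨i - 4, by omega⟩ : EdgeVar m l)
      simp only [src, tgt] at this
      convert! this using 2
      omega
    · subst h; exact hsrc q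
    · subst h; exact h1.trans (hsrc v)
    · have := hsrc (z ⟨i - (m + 6), by omega⟩ : EdgeVar m l)
      simp only [src, tgt] at this
      convert! this using 2
      omega
  have : Nonempty (Fin (l + 6 + m)) := ⟨⟨0, by omega⟩⟩
  exact SimpleGraph.Connected.mk fun i j => (hr i).symm.trans (hr j)

theorem not_isBipartite : ¬ (pendantGraph (m + 1) (l + 6 + m)).IsBipartite := by
  rintro ⟨c⟩
  have h1 := c.valid (adj_ends (p : EdgeVar m l))
  have h2 := c.valid (adj_ends (q : EdgeVar m l))
  have h3 := c.valid (adj_ends (r : EdgeVar m l))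
  simp only [src, tgt, ne_eq] at h1 h2 h3
  omega

/-! ### Fibres of the toric map -/

/-- The vertex degrees of the edge variables. -/
def vertexDegree (x : EdgeVar m l) : Fin (l + 6 + m) →₀ ℕ :=
  Finsupp.single (src x) 1 + Finsupp.single (tgt x) 1

theorem toricDegree_vertexDegree (α : EdgeVar m l →₀ ℕ) :
    toricDegree vertexDegree α =
      Finsupp.single ⟨0, by omega⟩ (α p + α q + ∑ j, α (a j) + ∑ i, α (z i)) +
      Finsupp.single ⟨1, by omega⟩ (α u + α v + ∑ j, α (b j)) +
      Finsupp.single ⟨2, by omega⟩ (α p + α r + α s) +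
      Finsupp.single ⟨3, by omega⟩ (α u + α w + α s) +
      Finsupp.single ⟨m + 4, by omega⟩ (α q + α r) +
      Finsupp.single ⟨m + 5, by omega⟩ (α v + α w) +
      ∑ j : Fin m, Finsupp.single ⟨4 + j, by omega⟩ (α (a j) + α (b j)) +
      ∑ i : Fin l, Finsupp.single ⟨m + 6 + i, by omega⟩ (α (z i)) := by
  rw [toricDegree_apply, sum_eq]
  simp only [vertexDegree, src, tgt, smul_add, Finsupp.smul_single, smul_eq_mul, mul_one,
    Finset.sum_add_distrib, Finsupp.single_add, ← Finsupp.single_finsetSum]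
  abel

/-- Two exponent vectors in the edge variables lie in the same fibre of the toric map; the degree
equations of the graph, with the pendant variables cancelled. -/
structure SameFibre (α β : EdgeVar m l →₀ ℕ) : Prop where
  z : ∀ i, α (z i) = β (z i)
  ab : ∀ j, α (a j) + α (b j) = β (a j) + β (b j)
  qr : α q + α r = β q + β r
  vw : α v + α w = β v + β w
  prs : α p + α r + α s = β p + β r + β s
  uws : α u + α w + α s = β u + β w + β s
  pqa : α p + α q + ∑ j, α (a j) = β p + β q + ∑ j, β (a j)
  uvb : α u + α v + ∑ j, α (b j) = β u + β v + ∑ j, β (b j)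

theorem sum_single_offset_apply {n o N : ℕ} (h : ∀ j : Fin n, o + j < N) (c : Fin n → ℕ)
    (k : Fin N) : (∑ i : Fin n, Finsupp.single (⟨o + i, h i⟩ : Fin N) (c i)) k =
      if hk : o ≤ k ∧ k - o < n then c ⟨k - o, hk.2⟩ else 0 := by
  rw [Finsupp.finsetSum_apply]
  split_ifs with hk
  · rw [Finset.sum_eq_single ⟨k - o, hk.2⟩]
    · rw [Finsupp.single_apply, if_pos (Fin.ext (by simp only; omega))]
    · intro i _ hij
      refine Finsupp.single_eq_of_ne fun h => hij (Fin.ext ?_)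
      have := congrArg Fin.val h
      simp only at this ⊢
      omega
    · simp
  · refine Finset.sum_eq_zero fun i _ => Finsupp.single_eq_of_ne fun h => hk ?_
    have := congrArg Fin.val h
    simp only at this
    omega

theorem toricDegree_eq_iff (α β : EdgeVar m l →₀ ℕ) :
    toricDegree vertexDegree α = toricDegree vertexDegree β ↔ SameFibre α β := by
  constructor
  · intro h
    rw [toricDegree_vertexDegree, toricDegree_vertexDegree] at h
    have hv := fun k hk => DFunLike.congr_fun h ⟨k, hk⟩
    simp only [Finsupp.add_apply, sum_single_offset_apply, Finsupp.single_apply,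
      Fin.mk.injEq] at hv
    have hz : ∀ i, α (EdgeVar.z i) = β (EdgeVar.z i) := fun i => by
      have := hv (m + 6 + i) (by omega)
      simp (disch := omega) only [if_neg, dif_pos, dif_neg, Nat.add_sub_cancel_left, Fin.eta,
        add_zero, zero_add] at this
      exact this
    have hzs : ∑ i, α (EdgeVar.z i) = ∑ i, β (EdgeVar.z i) := Finset.sum_congr rfl fun i _ => hz i
    refine ⟨hz, fun j => ?_, ?_, ?_, ?_, ?_, ?_, ?_⟩
    · have := hv (4 + j) (by omega)
      simp (disch := omega) only [if_neg, dif_pos, dif_neg, Nat.add_sub_cancel_left, Fin.eta,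
        add_zero, zero_add] at this
      omega
    · have := hv (m + 4) (by omega)
      simp (disch := omega) only [↓reduceIte, if_neg, dif_neg, add_zero, zero_add] at this
      omega
    · have := hv (m + 5) (by omega)
      simp (disch := omega) only [↓reduceIte, if_neg, dif_neg, add_zero, zero_add] at this
      omega
    · have := hv 2 (by omega)
      simp (disch := omega) only [↓reduceIte, if_neg, dif_neg, add_zero, zero_add] at this
      omega
    · have := hv 3 (by omega)
      simp (disch := omega) only [↓reduceIte, if_neg, dif_neg, add_zero, zero_add] at this
      omega
    · have := hv 0 (by omega)
      simp (disch := omega) only [↓reduceIte, if_neg, dif_neg, add_zero] at this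
      omega
    · have := hv 1 (by omega)
      simp (disch := omega) only [↓reduceIte, if_neg, dif_neg, add_zero, zero_add] at this
      omega
  · intro h
    rw [toricDegree_vertexDegree, toricDegree_vertexDegree, h.qr, h.vw, h.prs, h.uws, h.pqa, h.uvb]
    simp only [h.ab, h.z]

end EdgeVar

/-! ### Gröbner bases for the two orders -/

section RankOrders

variable {ρ σ : Type*}

theorem exists_equiv_fin_of_rank [Fintype ρ] (rank : ρ → ℕ) (h : Function.Injective rank) :
    ∃ x : Fin (Fintype.card ρ) ≃ ρ, ∀ i j, i < j ↔ rank (x i) < rank (x j) := by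
  let _ : LinearOrder ρ := LinearOrder.lift' rank h
  exact ⟨(Fintype.orderIsoFinOfCardEq ρ rfl).toEquiv, fun i j =>
    ((Fintype.orderIsoFinOfCardEq ρ rfl).lt_iff_lt (x := i) (y := j)).symm⟩

theorem lexOrder_lt_of_rank {n : ℕ} {x : Fin n ≃ ρ} {rank : ρ → ℕ}
    (hx : ∀ i j, i < j ↔ rank (x i) < rank (x j)) (e : ρ ≃ σ) {α β : ρ →₀ ℕ} (c : ρ)
    (hc : β c < α c) (h : ∀ c', rank c' < rank c → β c' = α c') :
    β.equivMapDomain e ≺[lexOrder (x.trans e)] α.equivMapDomain e := by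
  rw [lexOrder_lt_iff]
  refine ⟨x.symm c, by simpa using hc, fun j hj => ?_⟩
  rw [hx, Equiv.apply_symm_apply] at hj
  simpa using h _ hj

theorem revLexOrder_lt_of_rank [Fintype ρ] {n : ℕ} {x : Fin n ≃ ρ} {rank : ρ → ℕ}
    (hx : ∀ i j, i < j ↔ rank (x i) < rank (x j)) (e : ρ ≃ σ) {α β : ρ →₀ ℕ}
    (hdeg : β.degree = α.degree) (c : ρ) (hc : α c < β c)
    (h : ∀ c', rank c < rank c' → β c' = α c') :
    β.equivMapDomain e ≺[revLexOrder (x.trans e)] α.equivMapDomain e := by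
  have := Fintype.ofEquiv ρ e
  have hd : ∀ γ : ρ →₀ ℕ, (γ.equivMapDomain e).degree = γ.degree := fun γ => by
    rw [Finsupp.degree_eq_sum, Finsupp.degree_eq_sum, ← e.sum_comp]
    simp
  rw [revLexOrder_lt_iff, hd, hd]
  refine Or.inr ⟨hdeg, x.symm c, by simpa using hc, fun j hj => ?_⟩
  rw [hx, Equiv.apply_symm_apply] at hj
  simpa using h _ hj

end RankOrders

namespace EdgeVar

variable {m l : ℕ}

/-- The ordering of the variables for the lexicographic order: `r > p > a 0 > a 1 > ⋯`, followed by
the others. -/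
def lexRank : EdgeVar m l → ℕ
  | r => 0
  | p => 1
  | a j => 2 + j
  | q => m + 2
  | s => m + 3
  | u => m + 4
  | v => m + 5
  | w => m + 6
  | b j => m + 7 + j
  | z i => m + 7 + m + i

/-- The ordering of the variables for the reverse lexicographic order: the smallest ones are
`a 0 > a 1 > ⋯ > p > r`. -/
def revRank : EdgeVar m l → ℕ
  | q => 0
  | s => 1
  | u => 2
  | v => 3
  | w => 4
  | b j => 5 + j
  | z i => 5 + m + i
  | a j => 5 + m + l + j
  | p => 5 + m + l + m
  | r => 6 + m + l + m

theorem lexRank_injective : Function.Injective (lexRank : EdgeVar m l → ℕ) := by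
  intro x y h
  cases x <;> cases y <;> simp only [lexRank, reduceCtorEq, a.injEq, b.injEq, z.injEq] at h ⊢ <;>
    omega

theorem revRank_injective : Function.Injective (revRank : EdgeVar m l → ℕ) := by
  intro x y h
  cases x <;> cases y <;> simp only [revRank, reduceCtorEq, a.injEq, b.injEq, z.injEq] at h ⊢ <;>
    omega

/-- Exponents of the monomial ideal generated by `q s b_j`, `s v a_j`, `q v s²`, `p q w b_i b_j` and
`a_i b_j` for `i < j`. -/
def revUpper (m l : ℕ) : Set (EdgeVar m l →₀ ℕ) :=
  {α | (∃ j, 0 < α q ∧ 0 < α s ∧ 0 < α (b j)) ∨ (∃ j, 0 < α s ∧ 0 < α v ∧ 0 < α (a j)) ∨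
    (0 < α q ∧ 0 < α v ∧ 2 ≤ α s) ∨ (0 < α p ∧ 0 < α q ∧ 0 < α w ∧ 2 ≤ ∑ j, α (b j)) ∨
    ∃ i j, i < j ∧ 0 < α (a i) ∧ 0 < α (b j)}

/-- Exponents of the monomial ideal generated by `r u a_j`, `p w b_j`, `p r u w` and `a_i b_j` for
`i < j`. -/
def lexUpper (m l : ℕ) : Set (EdgeVar m l →₀ ℕ) :=
  {α | (∃ j, 0 < α r ∧ 0 < α u ∧ 0 < α (a j)) ∨ (∃ j, 0 < α p ∧ 0 < α w ∧ 0 < α (b j)) ∨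
    (0 < α p ∧ 0 < α r ∧ 0 < α u ∧ 0 < α w) ∨ ∃ i j, i < j ∧ 0 < α (a i) ∧ 0 < α (b j)}

theorem SameFibre.symm {α β : EdgeVar m l →₀ ℕ} (h : SameFibre α β) : SameFibre β α :=
  ⟨fun i => (h.z i).symm, fun j => (h.ab j).symm, h.qr.symm, h.vw.symm, h.prs.symm, h.uws.symm,
    h.pqa.symm, h.uvb.symm⟩

theorem SameFibre.sum_ab {α β : EdgeVar m l →₀ ℕ} (h : SameFibre α β) :
    ∑ j, α (EdgeVar.a j) + ∑ j, α (EdgeVar.b j) =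
      ∑ j, β (EdgeVar.a j) + ∑ j, β (EdgeVar.b j) := by
  rw [← Finset.sum_add_distrib, ← Finset.sum_add_distrib]
  exact Finset.sum_congr rfl fun j _ => h.ab j

/-- A monomial in the `a_j` and `b_j` without a factor `a_i b_j`, `i < j`, is determined by its
multidegree. -/
theorem eq_of_chain {f f' g g' : Fin m → ℕ} (hsum : ∀ j, f j + g j = f' j + g' j)
    (htot : ∑ j, f j = ∑ j, f' j) (h : ∀ i j, i < j → f i = 0 ∨ g j = 0)
    (h' : ∀ i j, i < j → f' i = 0 ∨ g' j = 0) : f = f' := by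
  -- At the first difference, say `f i < f' i`, all later `g' j` vanish, so `f ≤ f'` everywhere.
  have key : ∀ {f f' g g' : Fin m → ℕ}, (∀ j, f j + g j = f' j + g' j) →
      ∑ j, f j = ∑ j, f' j → (∀ i j, i < j → f' i = 0 ∨ g' j = 0) →
      ∀ i, (∀ j < i, f j = f' j) → ¬ f i < f' i := by
    intro f f' g g' hsum htot h' i hlt hi
    refine absurd htot (Finset.sum_lt_sum (fun j _ => ?_) ⟨i, Finset.mem_univ _, hi⟩).ne
    rcases lt_trichotomy j i with hj | rfl | hj
    · exact (hlt j hj).le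
    · exact hi.le
    · have := hsum j
      rcases h' i j hj with h0 | h0 <;> omega
  funext i
  induction i using WellFoundedLT.induction with
  | ind i ih =>
    have h1 := key hsum htot h' i ih
    have h2 := key (fun j => (hsum j).symm) htot.symm h i fun j hj => (ih j hj).symm
    omega

/-- In a fibre, the exponents of `q` and `v` determine those of the other variables, apart from the
distribution of the exponents between `a_j` and `b_j`. -/
theorem SameFibre.eq_of_chain {α β : EdgeVar m l →₀ ℕ} (h : SameFibre α β)
    (hα : ¬ ∃ i j, i < j ∧ 0 < α (EdgeVar.a i) ∧ 0 < α (EdgeVar.b j))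
    (hβ : ¬ ∃ i j, i < j ∧ 0 < β (EdgeVar.a i) ∧ 0 < β (EdgeVar.b j))
    (hq : α q = β q) (hv : α v = β v) : α = β := by
  have h1 := h.qr
  have h2 := h.vw
  have h3 := h.prs
  have h4 := h.uws
  have h5 := h.pqa
  have h6 := h.uvb
  have h7 := h.sum_ab
  have hsum : ∀ j, α (EdgeVar.a j) + α (EdgeVar.b j) = β (EdgeVar.a j) + β (EdgeVar.b j) := h.ab
  have ha : (fun j => α (EdgeVar.a j)) = fun j => β (EdgeVar.a j) := by
    refine EdgeVar.eq_of_chain hsum (by omega) (fun i j hij => ?_) fun i j hij => ?_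
    · by_contra hcon
      exact hα ⟨i, j, hij, by omega, by omega⟩
    · by_contra hcon
      exact hβ ⟨i, j, hij, by omega, by omega⟩
  have ha' : ∀ j, α (EdgeVar.a j) = β (EdgeVar.a j) := congrFun ha
  ext x
  cases x with
  | a j => exact ha' j
  | b j => have := hsum j; have := ha' j; omega
  | z i => exact h.z i
  | _ => omega

theorem eq_of_notMem_revUpper {α β : EdgeVar m l →₀ ℕ} (hα : α ∉ revUpper m l)
    (hβ : β ∉ revUpper m l) (h : SameFibre α β) : α = β := by
  have hq : ∀ {α β : EdgeVar m l →₀ ℕ}, β ∉ revUpper m l → SameFibre α β → ¬ α q < β q := by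
    intro α β hβ h hlt
    have h1 := h.qr
    have h2 := h.vw
    have h3 := h.prs
    have h4 := h.uws
    have h5 := h.pqa
    have h6 := h.uvb
    have h7 := h.sum_ab
    simp only [revUpper, Set.mem_ofPred_eq, not_or] at hβ
    obtain ⟨hβ1, -, hβ3, hβ4, -⟩ := hβ
    rcases lt_trichotomy (α v) (β v) with hv | hv | hv
    · exact hβ3 (by omega)
    · have : ∑ j, β (EdgeVar.b j) = 0 := Finset.sum_eq_zero fun j _ => by
        by_contra hb
        exact hβ1 ⟨j, by omega⟩
      omega
    · exact hβ4 (by omega)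
  have hv : ∀ {α β : EdgeVar m l →₀ ℕ}, β ∉ revUpper m l → SameFibre α β → α q = β q →
      ¬ α v < β v := by
    intro α β hβ h hq hlt
    have h1 := h.qr
    have h2 := h.vw
    have h3 := h.prs
    have h4 := h.uws
    have h5 := h.pqa
    have h6 := h.uvb
    have h7 := h.sum_ab
    simp only [revUpper, Set.mem_ofPred_eq, not_or] at hβ
    obtain ⟨-, hβ2, -⟩ := hβ
    have : ∑ j, β (EdgeVar.a j) = 0 := Finset.sum_eq_zero fun j _ => by
      by_contra hb
      exact hβ2 ⟨j, by omega⟩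
    omega
  have h1 := hq hβ h
  have h2 := hq hα h.symm
  have h3 := hv hβ h (by omega)
  have h4 := hv hα h.symm (by omega)
  simp only [revUpper, Set.mem_ofPred_eq, not_or] at hα hβ
  exact h.eq_of_chain hα.2.2.2.2 hβ.2.2.2.2 (by omega) (by omega)

theorem eq_of_notMem_lexUpper {α β : EdgeVar m l →₀ ℕ} (hα : α ∉ lexUpper m l)
    (hβ : β ∉ lexUpper m l) (h : SameFibre α β) : α = β := by
  have hq : ∀ {α β : EdgeVar m l →₀ ℕ}, α ∉ lexUpper m l → SameFibre α β → ¬ α q < β q := by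
    intro α β hα h hlt
    have h1 := h.qr
    have h2 := h.vw
    have h3 := h.prs
    have h4 := h.uws
    have h5 := h.pqa
    have h6 := h.uvb
    have h7 := h.sum_ab
    simp only [lexUpper, Set.mem_ofPred_eq, not_or] at hα
    obtain ⟨hα1, -, hα3, -⟩ := hα
    have : ∑ j, α (EdgeVar.a j) = 0 := Finset.sum_eq_zero fun j _ => by
      by_contra hb
      exact hα1 ⟨j, by omega⟩
    omega
  have hv : ∀ {α β : EdgeVar m l →₀ ℕ}, α ∉ lexUpper m l → SameFibre α β → α q = β q →
      ¬ α v < β v := by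
    intro α β hα h hq hlt
    have h1 := h.qr
    have h2 := h.vw
    have h3 := h.prs
    have h4 := h.uws
    have h5 := h.pqa
    have h6 := h.uvb
    have h7 := h.sum_ab
    simp only [lexUpper, Set.mem_ofPred_eq, not_or] at hα
    obtain ⟨-, hα2, -⟩ := hα
    have : ∑ j, α (EdgeVar.b j) = 0 := Finset.sum_eq_zero fun j _ => by
      by_contra hb
      exact hα2 ⟨j, by omega⟩
    omega
  have h1 := hq hα h
  have h2 := hq hβ h.symm
  have h3 := hv hα h (by omega)
  have h4 := hv hβ h.symm (by omega)
  simp only [lexUpper, Set.mem_ofPred_eq, not_or] at hα hβ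
  exact h.eq_of_chain hα.2.2.2 hβ.2.2.2 (by omega) (by omega)

/-- Replacing the factor `x^λ` of `x^α` by the smaller monomial `x^μ` of the same fibre. -/
theorem exists_smaller_of_le {σ : Type*} (M : MonomialOrder σ) (e : EdgeVar m l ≃ σ)
    {α : EdgeVar m l →₀ ℕ} (lead trail : EdgeVar m l →₀ ℕ) (hle : lead ≤ α)
    (hfib : SameFibre trail lead)
    (hlt : trail.equivMapDomain e ≺[M] lead.equivMapDomain e) :
    ∃ β : EdgeVar m l →₀ ℕ, β.equivMapDomain e ≺[M] α.equivMapDomain e ∧ SameFibre β α := by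
  obtain ⟨γ, rfl⟩ := le_iff_exists_add.1 hle
  have hadd : ∀ μ ν : EdgeVar m l →₀ ℕ,
      (μ + ν).equivMapDomain e = μ.equivMapDomain e + ν.equivMapDomain e := fun μ ν => by
    ext; simp
  refine ⟨trail + γ, ?_, ?_⟩
  · rw [hadd, hadd, map_add, map_add]
    gcongr
  · rw [← toricDegree_eq_iff] at hfib ⊢
    rw [map_add, map_add, hfib]

theorem exists_single_add_single_le {f : Fin m → ℕ} (h : 2 ≤ ∑ j, f j) :
    ∃ i j, (Pi.single i 1 + Pi.single j 1 : Fin m → ℕ) ≤ f := by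
  obtain ⟨i, -, hi⟩ := Finset.exists_ne_zero_of_sum_ne_zero (by omega : ∑ j, f j ≠ 0)
  have h1 : f = Pi.single i 1 + (f - Pi.single i 1) := by
    funext j
    by_cases hj : j = i
    · subst hj; simp; omega
    · simp [hj]
  have h2 : ∑ j, (f - Pi.single i 1 : Fin m → ℕ) j ≠ 0 := fun h0 => by
    rw [h1] at h
    simp only [Pi.add_apply, Finset.sum_add_distrib, h0] at h
    simp at h
  obtain ⟨j, -, hj⟩ := Finset.exists_ne_zero_of_sum_ne_zero h2
  refine ⟨i, j, ?_⟩
  rw [h1]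
  refine add_le_add_right (fun k => ?_) _
  by_cases hk : k = j
  · subst hk; simpa using Nat.one_le_iff_ne_zero.2 hj
  · simp [hk]

/-- Every generator is the larger term of a binomial in the toric ideal. -/
theorem exists_smaller_of_mem_revUpper {σ : Type*} {n : ℕ} {x : Fin n ≃ EdgeVar m l}
    (hx : ∀ i j, i < j ↔ revRank (x i) < revRank (x j)) (e : EdgeVar m l ≃ σ)
    {α : EdgeVar m l →₀ ℕ} (hα : α ∈ revUpper m l) :
    ∃ β : EdgeVar m l →₀ ℕ,
      β.equivMapDomain e ≺[revLexOrder (x.trans e)] α.equivMapDomain e ∧ SameFibre β α := by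
  simp only [revUpper, Set.mem_ofPred_eq] at hα
  rcases hα with ⟨j, h1, h2, h3⟩ | ⟨j, h1, h2, h3⟩ | ⟨h1, h2, h3⟩ | ⟨h1, h2, h3, h4⟩ |
    ⟨i, j, hij, h1, h2⟩
  · refine exists_smaller_of_le _ e
      (Finsupp.single q 1 + Finsupp.single s 1 + Finsupp.single (b j) 1)
      (Finsupp.single r 1 + Finsupp.single u 1 + Finsupp.single (a j) 1) ?_ ?_ ?_
    · intro c
      cases c <;> simp [Finsupp.single_apply] <;> grind
    · constructor <;> simp [Finsupp.single_apply]
    · refine revLexOrder_lt_of_rank hx e (by simp) r (by simp) fun c hc => ?_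
      cases c <;> simp [revRank] at hc ⊢ <;> omega
  · refine exists_smaller_of_le _ e
      (Finsupp.single s 1 + Finsupp.single v 1 + Finsupp.single (a j) 1)
      (Finsupp.single p 1 + Finsupp.single w 1 + Finsupp.single (b j) 1) ?_ ?_ ?_
    · intro c
      cases c <;> simp [Finsupp.single_apply] <;> grind
    · constructor <;> simp [Finsupp.single_apply]
    · refine revLexOrder_lt_of_rank hx e (by simp) p (by simp) fun c hc => ?_
      cases c <;> simp [revRank] at hc ⊢ <;> omega
  · refine exists_smaller_of_le _ e
      (Finsupp.single q 1 + Finsupp.single v 1 + Finsupp.single s 2)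
      (Finsupp.single p 1 + Finsupp.single r 1 + Finsupp.single u 1 + Finsupp.single w 1) ?_ ?_ ?_
    · intro c
      cases c <;> simp <;> grind
    · constructor <;> simp
    · refine revLexOrder_lt_of_rank hx e (by simp) r (by simp) fun c hc => ?_
      cases c <;> simp [revRank] at hc ⊢ <;> omega
  · obtain ⟨i, j, hij⟩ := exists_single_add_single_le h4
    refine exists_smaller_of_le _ e
      (Finsupp.single p 1 + Finsupp.single q 1 + Finsupp.single w 1 + Finsupp.single (b i) 1 +
        Finsupp.single (b j) 1)
      (Finsupp.single r 1 + Finsupp.single u 1 + Finsupp.single v 1 + Finsupp.single (a i) 1 +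
        Finsupp.single (a j) 1) ?_ ?_ ?_
    · intro c
      cases c with
      | b k =>
        have := hij k
        simp only [Pi.add_apply, Pi.single_apply] at this
        simp [Finsupp.single_apply]
        grind
      | _ => simp <;> grind
    · constructor <;> simp [Finsupp.single_apply, Finset.sum_add_distrib]
    · refine revLexOrder_lt_of_rank hx e (by simp) r (by simp) fun c hc => ?_
      cases c <;> simp [revRank] at hc ⊢ <;> omega
  · refine exists_smaller_of_le _ e
      (Finsupp.single (a i) 1 + Finsupp.single (b j) 1)
      (Finsupp.single (a j) 1 + Finsupp.single (b i) 1) ?_ ?_ ?_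
    · intro c
      cases c <;> simp [Finsupp.single_apply] <;> grind
    · constructor <;> simp [Finsupp.single_apply]
      grind
    · refine revLexOrder_lt_of_rank hx e (by simp) (a j) (by simp [hij.ne']) fun c hc => ?_
      cases c <;> simp [revRank, Finsupp.single_apply] at hc ⊢ <;> grind

/-- Every generator is the larger term of a binomial in the toric ideal. -/
theorem exists_smaller_of_mem_lexUpper {σ : Type*} {n : ℕ} {x : Fin n ≃ EdgeVar m l}
    (hx : ∀ i j, i < j ↔ lexRank (x i) < lexRank (x j)) (e : EdgeVar m l ≃ σ)
    {α : EdgeVar m l →₀ ℕ} (hα : α ∈ lexUpper m l) :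
    ∃ β : EdgeVar m l →₀ ℕ,
      β.equivMapDomain e ≺[lexOrder (x.trans e)] α.equivMapDomain e ∧ SameFibre β α := by
  simp only [lexUpper, Set.mem_ofPred_eq] at hα
  rcases hα with ⟨j, h1, h2, h3⟩ | ⟨j, h1, h2, h3⟩ | ⟨h1, h2, h3, h4⟩ | ⟨i, j, hij, h1, h2⟩
  · refine exists_smaller_of_le _ e
      (Finsupp.single r 1 + Finsupp.single u 1 + Finsupp.single (a j) 1)
      (Finsupp.single q 1 + Finsupp.single s 1 + Finsupp.single (b j) 1) ?_ ?_ ?_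
    · intro c
      cases c <;> simp [Finsupp.single_apply] <;> grind
    · constructor <;> simp [Finsupp.single_apply]
    · refine lexOrder_lt_of_rank hx e r (by simp) fun c hc => ?_
      cases c <;> simp [lexRank] at hc ⊢
  · refine exists_smaller_of_le _ e
      (Finsupp.single p 1 + Finsupp.single w 1 + Finsupp.single (b j) 1)
      (Finsupp.single s 1 + Finsupp.single v 1 + Finsupp.single (a j) 1) ?_ ?_ ?_
    · intro c
      cases c <;> simp [Finsupp.single_apply] <;> grind
    · constructor <;> simp [Finsupp.single_apply]
    · refine lexOrder_lt_of_rank hx e p (by simp) fun c hc => ?_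
      cases c <;> simp [lexRank] at hc ⊢
  · refine exists_smaller_of_le _ e
      (Finsupp.single p 1 + Finsupp.single r 1 + Finsupp.single u 1 + Finsupp.single w 1)
      (Finsupp.single q 1 + Finsupp.single v 1 + Finsupp.single s 2) ?_ ?_ ?_
    · intro c
      cases c <;> simp <;> grind
    · constructor <;> simp
    · refine lexOrder_lt_of_rank hx e r (by simp) fun c hc => ?_
      cases c <;> simp [lexRank] at hc ⊢
  · refine exists_smaller_of_le _ e
      (Finsupp.single (a i) 1 + Finsupp.single (b j) 1)
      (Finsupp.single (a j) 1 + Finsupp.single (b i) 1) ?_ ?_ ?_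
    · intro c
      cases c <;> simp [Finsupp.single_apply] <;> grind
    · constructor <;> simp [Finsupp.single_apply]
      grind
    · refine lexOrder_lt_of_rank hx e (a i) (by simp [hij.ne]) fun c hc => ?_
      cases c <;> simp [lexRank, Finsupp.single_apply] at hc ⊢ <;> grind

end EdgeVar

/-! ### Depth of the reverse lexicographic initial ideal -/

/-- Splitting along the variables `…, x 1, x 0` in turn. -/
theorem IsRegularModMono.pivots_rev {σ K : Type*} [Field K] {n : ℕ} {U : Set (σ →₀ ℕ)}
    {rs : List (MvPolynomial σ K)} (x : Fin n → σ) (U₁ : Fin n → Set (σ →₀ ℕ))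
    (U₂ : Set (σ →₀ ℕ))
    (hU₁ : ∀ t α, α ∈ U₁ t ↔ Finsupp.single (x t) 1 + α ∈ U ∨
      ∃ i, t < i ∧ 0 < (Finsupp.single (x t) 1 + α : σ →₀ ℕ) (x i))
    (h₁ : ∀ t, IsRegularModMono K (U₁ t) rs)
    (hU₂ : ∀ α, α ∈ U₂ ↔ α ∈ U ∨ ∃ i, 0 < α (x i)) (h₂ : IsRegularModMono K U₂ rs) :
    IsRegularModMono K U rs := by
  refine IsRegularModMono.pivots (x ∘ Fin.rev) (U₁ ∘ Fin.rev) U₂ (fun t α => ?_)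
    (fun t => h₁ _) (fun α => ?_) h₂
  · rw [Function.comp_apply, hU₁, Fin.rev_surjective.exists]
    simp only [Fin.rev_lt_rev, Function.comp_apply]
  · rw [hU₂, Fin.rev_surjective.exists]
    rfl

namespace EdgeVar

variable {m l : ℕ} (K : Type*) [Field K]

/-- The coefficient vectors of the linear forms `p + v`, `q + w`, `q + s + ∑ b_j`,
`s + v + ∑ a_j`, `r`, `u` and `z_i`. -/
def revColumn : EdgeVar m l → (Fin 6 ⊕ Fin l → K)
  | p => Pi.single (.inl 0) 1
  | q => Pi.single (.inl 1) 1 + Pi.single (.inl 2) 1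
  | r => Pi.single (.inl 4) 1
  | s => Pi.single (.inl 2) 1 + Pi.single (.inl 3) 1
  | u => Pi.single (.inl 5) 1
  | v => Pi.single (.inl 0) 1 + Pi.single (.inl 3) 1
  | w => Pi.single (.inl 1) 1
  | a _ => Pi.single (.inl 3) 1
  | b _ => Pi.single (.inl 2) 1
  | z i => Pi.single (.inr i) 1

variable {K}

theorem exists_iff {P : EdgeVar m l → Prop} :
    (∃ x, P x) ↔ P p ∨ P q ∨ P r ∨ P s ∨ P u ∨ P v ∨ P w ∨ (∃ j, P (a j)) ∨ (∃ j, P (b j)) ∨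
      ∃ i, P (z i) := by
  refine ⟨?_, by grind⟩
  rintro ⟨x, hx⟩
  cases x <;> grind

theorem single_add_apply_pos {σ : Type*} {x y : σ} {α : σ →₀ ℕ} :
    0 < (Finsupp.single x 1 + α : σ →₀ ℕ) y ↔ x = y ∨ 0 < α y := by
  classical
  rw [Finsupp.add_apply, Finsupp.single_apply]
  split_ifs <;> simp_all

theorem exists_pos_of_two_le_sum {f : Fin m → ℕ} (h : 2 ≤ ∑ j, f j) : ∃ j, 0 < f j := by
  obtain ⟨i, -, hi⟩ := Finset.exists_ne_zero_of_sum_ne_zero (by omega : ∑ j, f j ≠ 0)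
  exact ⟨i, Nat.pos_of_ne_zero hi⟩

/-- Independence of the linear forms modulo the variables in `D`, as a linear system for the
coefficients of the first four forms. -/
theorem isRegularModMono_formList_revColumn_varUpper {U : Set (EdgeVar m l →₀ ℕ)}
    (D : Set (EdgeVar m l))
    (hU : ∀ α, α ∈ U ↔ ∃ x ∈ D, 0 < α x)
    (hr : r ∉ D) (hu : u ∉ D) (hz : ∀ i, z i ∉ D)
    (h : ∀ c₀ c₁ c₂ c₃ : K, (p ∉ D → c₀ = 0) → (w ∉ D → c₁ = 0) → (q ∉ D → c₁ + c₂ = 0) →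
      (v ∉ D → c₀ + c₃ = 0) → (s ∉ D → c₂ + c₃ = 0) → (∀ j, a j ∉ D → c₃ = 0) →
      (∀ j, b j ∉ D → c₂ = 0) → c₀ = 0 ∧ c₁ = 0 ∧ c₂ = 0 ∧ c₃ = 0) :
    IsRegularModMono K U (formList (revColumn K)) := by
  refine isRegularModMono_varUpper D hU fun t ht => ?_
  have h0 := h (t (.inl 0)) (t (.inl 1)) (t (.inl 2)) (t (.inl 3))
    (fun hx => by simpa [revColumn] using ht p hx) (fun hx => by simpa [revColumn] using ht w hx)
    (fun hx => by simpa [revColumn] using ht q hx) (fun hx => by simpa [revColumn] using ht v hx)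
    (fun hx => by simpa [revColumn] using ht s hx)
    (fun j hx => by simpa [revColumn] using ht (a j) hx)
    (fun j hx => by simpa [revColumn] using ht (b j) hx)
  funext i
  rcases i with i | i
  · fin_cases i
    · exact h0.1
    · exact h0.2.1
    · exact h0.2.2.1
    · exact h0.2.2.2
    · simpa [revColumn] using ht r hr
    · simpa [revColumn] using ht u hu
  · simpa [revColumn] using ht (z i) (hz i)

/-- The ideal generated by `s`, `p q w b_j`, `a_j` for `j < t` and `b_j` for `j > t`. -/
theorem isRegularModMono_rev_colon_b (t : Fin m) : IsRegularModMono K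
    {α : EdgeVar m l →₀ ℕ | 0 < α s ∨ (∃ j, 0 < α p ∧ 0 < α q ∧ 0 < α w ∧ 0 < α (b j)) ∨
      (∃ j < t, 0 < α (a j)) ∨ ∃ j, t < j ∧ 0 < α (b j)} (formList (revColumn K)) := by
  refine IsRegularModMono.pivot p
    (U₁ := {α | 0 < α s ∨ (∃ j, 0 < α q ∧ 0 < α w ∧ 0 < α (b j)) ∨
      (∃ j < t, 0 < α (a j)) ∨ ∃ j, t < j ∧ 0 < α (b j)})
    (U₂ := {α | 0 < α s ∨ 0 < α p ∨ (∃ j < t, 0 < α (a j)) ∨ ∃ j, t < j ∧ 0 < α (b j)})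
    (fun α => by simp) ?_ (fun α => by simp; grind) ?_
  · refine IsRegularModMono.pivot q
      (U₁ := {α | 0 < α s ∨ (∃ j, 0 < α w ∧ 0 < α (b j)) ∨
        (∃ j < t, 0 < α (a j)) ∨ ∃ j, t < j ∧ 0 < α (b j)})
      (U₂ := {α | 0 < α s ∨ 0 < α q ∨ (∃ j < t, 0 < α (a j)) ∨ ∃ j, t < j ∧ 0 < α (b j)})
      (fun α => by simp) ?_ (fun α => by simp; grind) ?_
    · refine IsRegularModMono.pivot w
        (U₁ := {α | 0 < α s ∨ (∃ j, 0 < α (b j)) ∨ ∃ j < t, 0 < α (a j)})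
        (U₂ := {α | 0 < α s ∨ 0 < α w ∨ (∃ j < t, 0 < α (a j)) ∨ ∃ j, t < j ∧ 0 < α (b j)})
        (fun α => by simp; grind) ?_ (fun α => by simp; grind) ?_
      · refine isRegularModMono_formList_revColumn_varUpper
          ({s} ∪ a '' Set.Iio t ∪ Set.range b) (fun α => by simp [exists_iff]; grind) (by simp)
          (by simp) (by simp) fun c₀ c₁ c₂ c₃ hp hw hq hv hs ha hb => ?_
        have ha := ha t
        have hb := hb t
        simp at hp hw hq hv hs ha hb
        grind
      · refine isRegularModMono_formList_revColumn_varUpper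
          ({s, w} ∪ a '' Set.Iio t ∪ b '' Set.Ioi t) (fun α => by simp [exists_iff]) (by simp)
          (by simp) (by simp) fun c₀ c₁ c₂ c₃ hp hw hq hv hs ha hb => ?_
        have ha := ha t
        have hb := hb t
        simp at hp hw hq hv hs ha hb
        grind
    · refine isRegularModMono_formList_revColumn_varUpper
        ({s, q} ∪ a '' Set.Iio t ∪ b '' Set.Ioi t) (fun α => by simp [exists_iff]; grind) (by simp)
        (by simp) (by simp) fun c₀ c₁ c₂ c₃ hp hw hq hv hs ha hb => ?_
      have ha := ha t
      have hb := hb t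
      simp at hp hw hq hv hs ha hb
      grind
  · refine isRegularModMono_formList_revColumn_varUpper
      ({s, p} ∪ a '' Set.Iio t ∪ b '' Set.Ioi t) (fun α => by simp [exists_iff]; grind) (by simp)
      (by simp) (by simp) fun c₀ c₁ c₂ c₃ hp hw hq hv hs ha hb => ?_
    have ha := ha t
    have hb := hb t
    simp at hp hw hq hv hs ha hb
    grind

/-- The ideal generated by `s`, `p q w b_i b_j` and `a_i b_j`, `i < j`. -/
theorem isRegularModMono_rev_add_s : IsRegularModMono K
    {α : EdgeVar m l →₀ ℕ | 0 < α s ∨ (0 < α p ∧ 0 < α q ∧ 0 < α w ∧ 2 ≤ ∑ j, α (b j)) ∨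
      ∃ i j, i < j ∧ 0 < α (a i) ∧ 0 < α (b j)} (formList (revColumn K)) := by
  refine IsRegularModMono.pivots_rev b _ (U₂ := {α | 0 < α s ∨ ∃ j, 0 < α (b j)})
    (fun t α => ?_) isRegularModMono_rev_colon_b (fun α => ?_) ?_
  · have h : 2 ≤ 1 + ∑ j, α (b j) ↔ ∃ j, 0 < α (b j) := by
      rw [show (2 ≤ 1 + ∑ j, α (b j)) ↔ 0 < ∑ j, α (b j) by omega, Finset.sum_pos_iff]
      simp
    have h' : 2 ≤ ∑ j, (Finsupp.single (b t) 1 + α : EdgeVar m l →₀ ℕ) (b j) ↔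
        ∃ j, 0 < α (b j) := by
      rw [← h]
      simp [Finsupp.single_apply, Finset.sum_add_distrib]
    simp [↓single_add_apply_pos, -Finsupp.coe_add, h']
    grind
  · have h := exists_pos_of_two_le_sum (f := fun j => α (b j))
    simp
    grind
  · refine isRegularModMono_formList_revColumn_varUpper
      ({s} ∪ Set.range b) (fun α => by simp) (by simp)
      (by simp) (by simp) fun c₀ c₁ c₂ c₃ hp hw hq hv hs ha hb => ?_
    simp at hp hw hq hv hs ha hb
    grind

/-- The ideal generated by `s`, `q b_j`, `v a_j` and `a_i b_j`, `i < j`. -/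
theorem isRegularModMono_rev_colon_s_add_s : IsRegularModMono K
    {α : EdgeVar m l →₀ ℕ | 0 < α s ∨ (∃ j, 0 < α q ∧ 0 < α (b j)) ∨
      (∃ j, 0 < α v ∧ 0 < α (a j)) ∨ ∃ i j, i < j ∧ 0 < α (a i) ∧ 0 < α (b j)}
    (formList (revColumn K)) := by
  refine IsRegularModMono.pivots a
    (U₁ := fun t => {α | 0 < α s ∨ 0 < α v ∨ (∃ j, 0 < α q ∧ 0 < α (b j)) ∨
      (∃ j < t, 0 < α (a j)) ∨ ∃ j, t < j ∧ 0 < α (b j)})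
    (U₂ := {α | 0 < α s ∨ (∃ j, 0 < α q ∧ 0 < α (b j)) ∨ ∃ j, 0 < α (a j)})
    (fun t α => ?_) (fun t => ?_) (fun α => ?_) ?_
  · simp [↓single_add_apply_pos]
    grind
  · refine IsRegularModMono.pivot q
      (U₁ := {α | 0 < α s ∨ 0 < α v ∨ (∃ j, 0 < α (b j)) ∨ ∃ j < t, 0 < α (a j)})
      (U₂ := {α | 0 < α s ∨ 0 < α v ∨ 0 < α q ∨ (∃ j < t, 0 < α (a j)) ∨
        ∃ j, t < j ∧ 0 < α (b j)})
      (fun α => by simp; grind) ?_ (fun α => by simp; grind) ?_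
    · refine isRegularModMono_formList_revColumn_varUpper
        ({s, v} ∪ a '' Set.Iio t ∪ Set.range b) (fun α => by simp [exists_iff]; grind) (by simp)
        (by simp) (by simp) fun c₀ c₁ c₂ c₃ hp hw hq hv hs ha hb => ?_
      have ha := ha t
      have hb := hb t
      simp at hp hw hq hv hs ha hb
      grind
    · refine isRegularModMono_formList_revColumn_varUpper
        ({s, v, q} ∪ a '' Set.Iio t ∪ b '' Set.Ioi t)
        (fun α => by simp [exists_iff]; grind) (by simp)
        (by simp) (by simp) fun c₀ c₁ c₂ c₃ hp hw hq hv hs ha hb => ?_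
      have ha := ha t
      have hb := hb t
      simp at hp hw hq hv hs ha hb
      grind
  · simp
    grind
  · refine IsRegularModMono.pivots b
      (U₁ := fun t => {α | 0 < α s ∨ 0 < α q ∨ (∃ j, 0 < α (a j)) ∨ ∃ j < t, 0 < α (b j)})
      (U₂ := {α | 0 < α s ∨ (∃ j, 0 < α (a j)) ∨ ∃ j, 0 < α (b j)})
      (fun t α => ?_) (fun t => ?_) (fun α => ?_) ?_
    · simp [↓single_add_apply_pos]
      grind
    · refine isRegularModMono_formList_revColumn_varUpper
        ({s, q} ∪ Set.range a ∪ b '' Set.Iio t) (fun α => by simp [exists_iff]; grind) (by simp)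
        (by simp) (by simp) fun c₀ c₁ c₂ c₃ hp hw hq hv hs ha hb => ?_
      have ha := ha t
      have hb := hb t
      simp at hp hw hq hv hs ha hb
      grind
    · simp
      grind
    · refine isRegularModMono_formList_revColumn_varUpper
        ({s} ∪ Set.range a ∪ Set.range b) (fun α => by simp [exists_iff]) (by simp)
        (by simp) (by simp) fun c₀ c₁ c₂ c₃ hp hw hq hv hs ha hb => ?_
      simp at hp hw hq hv hs ha hb
      grind

/-- The ideal generated by `q b_j`, `v a_j`, `q v` and `a_i b_j`, `i < j`. -/
theorem isRegularModMono_rev_colon_sq : IsRegularModMono K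
    {α : EdgeVar m l →₀ ℕ | (∃ j, 0 < α q ∧ 0 < α (b j)) ∨ (∃ j, 0 < α v ∧ 0 < α (a j)) ∨
      (0 < α q ∧ 0 < α v) ∨ ∃ i j, i < j ∧ 0 < α (a i) ∧ 0 < α (b j)}
    (formList (revColumn K)) := by
  refine IsRegularModMono.pivot q
    (U₁ := {α | 0 < α v ∨ ∃ j, 0 < α (b j)})
    (U₂ := {α | 0 < α q ∨ (∃ j, 0 < α v ∧ 0 < α (a j)) ∨
      ∃ i j, i < j ∧ 0 < α (a i) ∧ 0 < α (b j)})
    (fun α => by simp; grind) ?_ (fun α => by simp; grind) ?_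
  · refine isRegularModMono_formList_revColumn_varUpper
      ({v} ∪ Set.range b) (fun α => by simp) (by simp)
      (by simp) (by simp) fun c₀ c₁ c₂ c₃ hp hw hq hv hs ha hb => ?_
    simp at hp hw hq hv hs ha hb
    grind
  · refine IsRegularModMono.pivots a
      (U₁ := fun t => {α | 0 < α q ∨ 0 < α v ∨ (∃ j < t, 0 < α (a j)) ∨ ∃ j, t < j ∧ 0 < α (b j)})
      (U₂ := {α | 0 < α q ∨ ∃ j, 0 < α (a j)})
      (fun t α => ?_) (fun t => ?_) (fun α => ?_) ?_
    · simp [↓single_add_apply_pos]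
      grind
    · refine isRegularModMono_formList_revColumn_varUpper
        ({q, v} ∪ a '' Set.Iio t ∪ b '' Set.Ioi t) (fun α => by simp [exists_iff]) (by simp)
        (by simp) (by simp) fun c₀ c₁ c₂ c₃ hp hw hq hv hs ha hb => ?_
      have ha := ha t
      have hb := hb t
      simp at hp hw hq hv hs ha hb
      grind
    · simp
      grind
    · refine isRegularModMono_formList_revColumn_varUpper
        ({q} ∪ Set.range a) (fun α => by simp) (by simp)
        (by simp) (by simp) fun c₀ c₁ c₂ c₃ hp hw hq hv hs ha hb => ?_
      simp at hp hw hq hv hs ha hb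
      grind

/-- The linear forms with coefficients `revColumn` are regular modulo the initial ideal `J`.
Splitting twice along `s` leaves `J + (s)`, `(J : s) + (s)` and `J : s²`. -/
theorem isRegularModMono_revUpper :
    IsRegularModMono K (revUpper m l) (formList (revColumn K)) := by
  refine IsRegularModMono.pivot s
    (U₁ := {α | (∃ j, 0 < α q ∧ 0 < α (b j)) ∨ (∃ j, 0 < α v ∧ 0 < α (a j)) ∨
      (0 < α q ∧ 0 < α v ∧ 0 < α s) ∨ ∃ i j, i < j ∧ 0 < α (a i) ∧ 0 < α (b j)})
    (fun α => ?_) ?_ (fun α => ?_) isRegularModMono_rev_add_s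
  · have h := exists_pos_of_two_le_sum (f := fun j => α (b j))
    simp [revUpper]
    grind
  · refine IsRegularModMono.pivot s (fun α => ?_) isRegularModMono_rev_colon_sq (fun α => ?_)
      isRegularModMono_rev_colon_s_add_s
    · simp
    · simp
      grind
  · simp [revUpper]
    grind

theorem isUpperSet_revUpper : IsUpperSet (revUpper m l) := by
  intro α β h hα
  have hs : ∑ j, α (b j) ≤ ∑ j, β (b j) := Finset.sum_le_sum fun j _ => h _
  have h0 := fun x => h x
  simp only [revUpper, Set.mem_ofPred_eq] at hα ⊢
  grind

theorem natCard_compl_rev :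
    Nat.card ↥(({s} ∪ Set.range a ∪ Set.range b : Set (EdgeVar m l))ᶜ) = 6 + l := by
  have h : ({s} ∪ Set.range a ∪ Set.range b : Set (EdgeVar m l))ᶜ =
      Set.range (Sum.elim ![p, q, r, u, v, w] z) := by
    ext x
    cases x <;> simp
  have hinj : Function.Injective
      (Sum.elim ![p, q, r, u, v, w] z : Fin 6 ⊕ Fin l → EdgeVar m l) := by
    refine Function.Injective.sumElim (fun i j => ?_) (fun i j => z.inj) fun i j => ?_
    · fin_cases i <;> fin_cases j <;> simp
    · fin_cases i <;> simp
  rw [h, Nat.card_range_of_injective hinj]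
  simp

/-- The colon ideal of `q s v` is the associated prime generated by `s` and all `a_j`, `b_j`. -/
theorem depthQuotient_revUpper : depthQuotient (monoIdeal K (revUpper m l)) = (6 + l : ℕ) := by
  have := depthQuotient_monoIdeal (K := K) (U := revUpper m l) isUpperSet_revUpper
    isRegularModMono_revUpper (D := {s} ∪ Set.range a ∪ Set.range b)
    (γ := Finsupp.single q 1 + Finsupp.single s 1 + Finsupp.single v 1)
    (fun α => ?_) (by rw [natCard_compl_rev]; simp)
  · rw [this]
    simp
  · have h := exists_pos_of_two_le_sum (f := fun j => α (b j))
    simp [revUpper, varUpper, exists_iff]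
    grind

end EdgeVar

/-! ### Depth and dimension of the lexicographic initial ideal -/

namespace EdgeVar

variable {m l : ℕ} (K : Type*) [Field K]

/-- The coefficient vectors of the linear forms `q`, `s`, `v`, `r + u`, `p + w`, `z_i` and of the
sums of neighbours `p + b_0`, `a_0 + b_1`, …, `a_{m-1} + r` (`p + r` if `m = 0`). -/
def lexColumn : EdgeVar m l → (Fin 5 ⊕ Fin l ⊕ Fin (m + 1) → K)
  | p => Pi.single (.inl 4) 1 + Pi.single (.inr (.inr 0)) 1
  | q => Pi.single (.inl 0) 1
  | r => Pi.single (.inl 3) 1 + Pi.single (.inr (.inr (Fin.last m))) 1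
  | s => Pi.single (.inl 1) 1
  | u => Pi.single (.inl 3) 1
  | v => Pi.single (.inl 2) 1
  | w => Pi.single (.inl 4) 1
  | a j => Pi.single (.inr (.inr j.succ)) 1
  | b j => Pi.single (.inr (.inr j.castSucc)) 1
  | z i => Pi.single (.inr (.inl i)) 1

variable {K}

/-- Independence of the linear forms modulo the variables in `D`, as a linear system for the
coefficients of `r + u`, `p + w` and the sums of neighbours. -/
theorem isRegularModMono_formList_lexColumn_varUpper {U : Set (EdgeVar m l →₀ ℕ)}
    (D : Set (EdgeVar m l)) (hU : ∀ α, α ∈ U ↔ ∃ x ∈ D, 0 < α x)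
    (hq : q ∉ D) (hs : s ∉ D) (hv : v ∉ D) (hz : ∀ i, z i ∉ D)
    (h : ∀ (c₀ c₁ : K) (c : Fin (m + 1) → K), (p ∉ D → c₁ + c 0 = 0) → (w ∉ D → c₁ = 0) →
      (r ∉ D → c₀ + c (Fin.last m) = 0) → (u ∉ D → c₀ = 0) → (∀ j, a j ∉ D → c j.succ = 0) →
      (∀ j, b j ∉ D → c j.castSucc = 0) → c₀ = 0 ∧ c₁ = 0 ∧ ∀ i, c i = 0) :
    IsRegularModMono K U (formList (lexColumn K)) := by
  refine isRegularModMono_varUpper D hU fun t ht => ?_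
  have h0 := h (t (.inl 3)) (t (.inl 4)) (fun i => t (.inr (.inr i)))
    (fun hx => by simpa [lexColumn] using ht p hx) (fun hx => by simpa [lexColumn] using ht w hx)
    (fun hx => by simpa [lexColumn] using ht r hx) (fun hx => by simpa [lexColumn] using ht u hx)
    (fun j hx => by simpa [lexColumn] using ht (a j) hx)
    (fun j hx => by simpa [lexColumn] using ht (b j) hx)
  funext i
  rcases i with i | i | i
  · fin_cases i
    · simpa [lexColumn] using ht q hq
    · simpa [lexColumn] using ht s hs
    · simpa [lexColumn] using ht v hv
    · exact h0.1
    · exact h0.2.1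
  · simpa [lexColumn] using ht (z i) (hz i)
  · exact h0.2.2 i

theorem eq_zero_of_chain {c : Fin (m + 1) → K} (t : Fin m)
    (ha : ∀ j, t ≤ j → c j.succ = 0) (hb : ∀ j ≤ t, c j.castSucc = 0) (i : Fin (m + 1)) :
    c i = 0 := by
  rcases le_or_gt i t.castSucc with h | h
  · have hi : (i : ℕ) < m := lt_of_le_of_lt h t.2
    exact hb ⟨i, hi⟩ h
  · obtain ⟨j, rfl⟩ := Fin.exists_succ_eq.2 (Fin.ne_zero_of_lt h)
    exact ha j (Fin.castSucc_lt_succ_iff.1 h)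

/-- The ideal generated by `x`, `r u a_j` and `a_i b_j`, `i < j`, where `x` is `p` or `w`. -/
theorem isRegularModMono_lex_of_eq {x : EdgeVar m l} (hx : x = p ∨ x = w) : IsRegularModMono K
    {α : EdgeVar m l →₀ ℕ | 0 < α x ∨ (∃ j, 0 < α r ∧ 0 < α u ∧ 0 < α (a j)) ∨
      ∃ i j, i < j ∧ 0 < α (a i) ∧ 0 < α (b j)} (formList (lexColumn K)) := by
  refine IsRegularModMono.pivots a
    (U₁ := fun t => {α | 0 < α x ∨ (0 < α r ∧ 0 < α u) ∨
      (∃ j < t, 0 < α (a j)) ∨ ∃ j, t < j ∧ 0 < α (b j)})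
    (U₂ := {α | 0 < α x ∨ ∃ j, 0 < α (a j)})
    (fun t α => ?_) (fun t => ?_) (fun α => ?_) ?_
  · rcases hx with rfl | rfl
    all_goals
      simp [↓single_add_apply_pos]
      grind
  · refine IsRegularModMono.pivot r
      (U₁ := {α | 0 < α x ∨ 0 < α u ∨ (∃ j < t, 0 < α (a j)) ∨ ∃ j, t < j ∧ 0 < α (b j)})
      (U₂ := {α | 0 < α x ∨ 0 < α r ∨ (∃ j < t, 0 < α (a j)) ∨ ∃ j, t < j ∧ 0 < α (b j)})
      (fun α => ?_) ?_ (fun α => ?_) ?_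
    · rcases hx with rfl | rfl <;> simp
    · refine isRegularModMono_formList_lexColumn_varUpper
        ({x, u} ∪ a '' Set.Iio t ∪ b '' Set.Ioi t) (fun α => by simp [exists_iff]; grind)
        (by rcases hx with rfl | rfl <;> simp) (by rcases hx with rfl | rfl <;> simp)
        (by rcases hx with rfl | rfl <;> simp) (by rcases hx with rfl | rfl <;> simp)
        fun c₀ c₁ c hp hw hr hu ha hb => ?_
      have hc := eq_zero_of_chain t
        (fun j hj => ha j (by rcases hx with rfl | rfl <;> simpa using hj))
        (fun j hj => hb j (by rcases hx with rfl | rfl <;> simpa using hj))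
      have h0 := hc 0
      have h1 := hc (Fin.last m)
      rcases hx with rfl | rfl
      all_goals
        simp at hp hw hr hu
        grind
    · simp
      grind
    · refine isRegularModMono_formList_lexColumn_varUpper
        ({x, r} ∪ a '' Set.Iio t ∪ b '' Set.Ioi t) (fun α => by simp [exists_iff]; grind)
        (by rcases hx with rfl | rfl <;> simp) (by rcases hx with rfl | rfl <;> simp)
        (by rcases hx with rfl | rfl <;> simp) (by rcases hx with rfl | rfl <;> simp)
        fun c₀ c₁ c hp hw hr hu ha hb => ?_
      have hc := eq_zero_of_chain t
        (fun j hj => ha j (by rcases hx with rfl | rfl <;> simpa using hj))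
        (fun j hj => hb j (by rcases hx with rfl | rfl <;> simpa using hj))
      have h0 := hc 0
      have h1 := hc (Fin.last m)
      rcases hx with rfl | rfl
      all_goals
        simp at hp hw hr hu
        grind
  · simp
    grind
  · refine isRegularModMono_formList_lexColumn_varUpper
      ({x} ∪ Set.range a) (fun α => by simp)
      (by rcases hx with rfl | rfl <;> simp) (by rcases hx with rfl | rfl <;> simp)
      (by rcases hx with rfl | rfl <;> simp) (by rcases hx with rfl | rfl <;> simp)
      fun c₀ c₁ c hp hw hr hu ha hb => ?_
    have hc : ∀ j : Fin m, c j.castSucc = 0 :=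
      fun j => hb j (by rcases hx with rfl | rfl <;> simp)
    have hl : c (Fin.last m) = 0 := by
      rcases hx with rfl | rfl
      all_goals
        simp at hr hu
        grind
    have hc' : ∀ i, c i = 0 := Fin.lastCases hl hc
    have h0 := hc' 0
    rcases hx with rfl | rfl
    all_goals
      simp at hp hw hr hu
      grind

/-- The linear forms with coefficients `lexColumn` are regular modulo the initial ideal; it is split
along `p`, then `w`, then `r`. -/
theorem isRegularModMono_lexUpper :
    IsRegularModMono K (lexUpper m l) (formList (lexColumn K)) := by
  refine IsRegularModMono.pivot p
    (U₁ := {α | (∃ j, 0 < α r ∧ 0 < α u ∧ 0 < α (a j)) ∨ (∃ j, 0 < α w ∧ 0 < α (b j)) ∨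
      (0 < α r ∧ 0 < α u ∧ 0 < α w) ∨ ∃ i j, i < j ∧ 0 < α (a i) ∧ 0 < α (b j)})
    (fun α => ?_) ?_ (fun α => ?_) (isRegularModMono_lex_of_eq (Or.inl rfl))
  · simp [lexUpper]
  · refine IsRegularModMono.pivot w
      (U₁ := {α | (0 < α r ∧ 0 < α u) ∨ ∃ j, 0 < α (b j)})
      (fun α => ?_) ?_ (fun α => ?_) (isRegularModMono_lex_of_eq (Or.inr rfl))
    · simp
      grind
    · refine IsRegularModMono.pivot r
        (U₁ := {α | 0 < α u ∨ ∃ j, 0 < α (b j)})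
        (U₂ := {α | 0 < α r ∨ ∃ j, 0 < α (b j)})
        (fun α => by simp) ?_ (fun α => by simp; grind) ?_
      · refine isRegularModMono_formList_lexColumn_varUpper
          ({u} ∪ Set.range b) (fun α => by simp)
          (by simp) (by simp) (by simp) (by simp) fun c₀ c₁ c hp hw hr hu ha hb => ?_
        simp at hp hw hr hu ha hb
        have hc : ∀ i, c i = 0 := Fin.cases (by grind) ha
        have h1 := hc (Fin.last m)
        grind
      · refine isRegularModMono_formList_lexColumn_varUpper
          ({r} ∪ Set.range b) (fun α => by simp)
          (by simp) (by simp) (by simp) (by simp) fun c₀ c₁ c hp hw hr hu ha hb => ?_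
        simp at hp hw hr hu ha hb
        have hc : ∀ i, c i = 0 := Fin.cases (by grind) ha
        have h1 := hc (Fin.last m)
        grind
    · simp
      grind
  · simp [lexUpper]
    grind

theorem isUpperSet_lexUpper : IsUpperSet (lexUpper m l) := by
  intro α β h hα
  have h0 := fun x => h x
  simp only [lexUpper, Set.mem_ofPred_eq] at hα ⊢
  grind

theorem natCard_compl_range {g : Option (Fin m) → EdgeVar m l} (hg : Function.Injective g) :
    Nat.card ↥((Set.range g)ᶜ) = 6 + l + m := by
  have h1 := Set.ncard_add_ncard_compl (Set.range g)
  have h2 : (Set.range g).ncard = m + 1 := by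
    rw [← Nat.card_coe_set_eq, Nat.card_range_of_injective hg]
    simp
  rw [h2, Nat.card_eq_fintype_card, card_eq, ← Nat.card_coe_set_eq] at h1
  omega

theorem elim_w_a_injective :
    Function.Injective fun o : Option (Fin m) => (o.elim w a : EdgeVar m l) := by
  rintro (_ | i) (_ | j) h <;> simp_all

/-- The colon ideal of `p r u` is the associated prime generated by `w` and all `a_j`. -/
theorem depthQuotient_lexUpper :
    depthQuotient (monoIdeal K (lexUpper m l)) = (6 + l + m : ℕ) := by
  have := depthQuotient_monoIdeal (K := K) (U := lexUpper m l) isUpperSet_lexUpper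
    isRegularModMono_lexUpper (D := Set.range fun o : Option (Fin m) => o.elim w a)
    (γ := Finsupp.single p 1 + Finsupp.single r 1 + Finsupp.single u 1)
    (fun α => ?_) (by rw [natCard_compl_range elim_w_a_injective]; simp; omega)
  · rw [this]
    congr 1
    simp
    omega
  · simp [lexUpper, varUpper, Option.exists]
    grind

/-- A prime ideal containing the ideal contains `m + 1` variables. -/
theorem exists_injective_X_mem {P : Ideal (MvPolynomial (EdgeVar m l) K)} [hP : P.IsPrime]
    (h : monoIdeal K (lexUpper m l) ≤ P) :
    ∃ g : Option (Fin m) → EdgeVar m l, Function.Injective g ∧ ∀ o, X (g o) ∈ P := by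
  have hmem : ∀ α ∈ lexUpper m l, ∃ x, 0 < α x ∧ (X x : MvPolynomial (EdgeVar m l) K) ∈ P := by
    intro α hα
    have h1 : monomial α (1 : K) ∈ P := h (Ideal.subset_span ⟨α, hα, rfl⟩)
    rw [monomial_eq, C_1, one_mul, Finsupp.prod, hP.prod_mem_iff] at h1
    obtain ⟨x, hx, hxP⟩ := h1
    exact ⟨x, Nat.pos_of_ne_zero (Finsupp.mem_support_iff.1 hx), hP.mem_of_pow_mem _ hxP⟩
  have hite : ∀ i j : Fin m, (0 < if i = j then 1 else 0) ↔ i = j := fun i j => by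
    split_ifs <;> simp_all
  have h1 : ∀ j, X r ∈ P ∨ X u ∈ P ∨ X (a j) ∈ P := fun j => by
    have := hmem (Finsupp.single r 1 + Finsupp.single u 1 + Finsupp.single (a j) 1)
      (Or.inl ⟨j, by simp⟩)
    simpa [exists_iff, Finsupp.single_apply, hite] using this
  have h2 : ∀ j, X p ∈ P ∨ X w ∈ P ∨ X (b j) ∈ P := fun j => by
    have := hmem (Finsupp.single p 1 + Finsupp.single w 1 + Finsupp.single (b j) 1)
      (Or.inr (Or.inl ⟨j, by simp⟩))
    simpa [exists_iff, Finsupp.single_apply, hite] using this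
  have h3 : (X p ∈ P ∨ X w ∈ P) ∨ X r ∈ P ∨ X u ∈ P := by
    have := hmem
      (Finsupp.single p 1 + Finsupp.single r 1 + Finsupp.single u 1 + Finsupp.single w 1)
      (Or.inr (Or.inr (Or.inl (by simp))))
    simp [exists_iff] at this
    tauto
  have h4 : ∀ i j, i < j → X (a i) ∈ P ∨ X (b j) ∈ P := fun i j hij => by
    have := hmem (Finsupp.single (a i) 1 + Finsupp.single (b j) 1)
      (Or.inr (Or.inr (Or.inr ⟨i, j, hij, by simp⟩)))
    simpa [exists_iff, Finsupp.single_apply, hite] using this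
  have hA : ∀ x : EdgeVar m l, x = p ∨ x = w → X x ∈ P → (∀ j, X (a j) ∈ P) →
      ∃ g : Option (Fin m) → EdgeVar m l, Function.Injective g ∧ ∀ o, X (g o) ∈ P := by
    refine fun x hx hxP ha => ⟨fun o => o.elim x a, ?_, ?_⟩
    · rintro (_ | i) (_ | j) h <;> rcases hx with rfl | rfl <;> simp_all
    · rintro (_ | j) <;> simp [hxP, ha]
  have hB : ∀ x : EdgeVar m l, x = r ∨ x = u → X x ∈ P → (∀ j, X (b j) ∈ P) →
      ∃ g : Option (Fin m) → EdgeVar m l, Function.Injective g ∧ ∀ o, X (g o) ∈ P := by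
    refine fun x hx hxP hb => ⟨fun o => o.elim x b, ?_, ?_⟩
    · rintro (_ | i) (_ | j) h <;> rcases hx with rfl | rfl <;> simp_all
    · rintro (_ | j) <;> simp [hxP, hb]
  have hAB : ∀ x y : EdgeVar m l, x = p ∨ x = w → y = r ∨ y = u → X x ∈ P → X y ∈ P →
      ∃ g : Option (Fin m) → EdgeVar m l, Function.Injective g ∧ ∀ o, X (g o) ∈ P := by
    intro x y hx hy hxP hyP
    by_cases ha : ∀ j, X (a j) ∈ P
    · exact hA x hx hxP ha
    · -- the first `a t` outside `P` is replaced by `y`, and the later ones by the `b j`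
      obtain ⟨t, ht, htmin⟩ := WellFounded.has_min (wellFounded_lt (α := Fin m))
        {j | X (a j) ∉ P} (by simpa [Set.Nonempty] using ha)
      refine ⟨fun o => o.elim x fun j => if j < t then a j else if t < j then b j else y, ?_, ?_⟩
      · rintro (_ | i) (_ | j) h <;> rcases hx with rfl | rfl <;> rcases hy with rfl | rfl <;>
          simp at h ⊢ <;> grind
      · rintro (_ | j)
        · exact hxP
        · rcases lt_trichotomy j t with hj | rfl | hj
          · have := htmin j
            simp at this
            simp [hj]
            grind
          · simpa using hyP
          · simpa [hj, hj.not_gt] using (h4 t j hj).resolve_left ht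
  by_cases hx : X p ∈ P ∨ X w ∈ P <;> by_cases hy : X r ∈ P ∨ X u ∈ P
  · rcases hx with hx | hx <;> rcases hy with hy | hy
    exacts [hAB p r (.inl rfl) (.inl rfl) hx hy, hAB p u (.inl rfl) (.inr rfl) hx hy,
      hAB w r (.inr rfl) (.inl rfl) hx hy, hAB w u (.inr rfl) (.inr rfl) hx hy]
  · have ha : ∀ j, X (a j) ∈ P := by grind
    rcases hx with hx | hx
    exacts [hA p (.inl rfl) hx ha, hA w (.inr rfl) hx ha]
  · have hb : ∀ j, X (b j) ∈ P := by grind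
    rcases hy with hy | hy
    exacts [hB r (.inl rfl) hy hb, hB u (.inr rfl) hy hb]
  · exact absurd h3 (by tauto)

theorem ringKrullDim_lexUpper :
    ringKrullDim (MvPolynomial (EdgeVar m l) K ⧸ monoIdeal K (lexUpper m l)) =
      (6 + l + m : ℕ) := by
  refine ringKrullDim_monoIdeal (fun P _ h => ?_)
    (D₀ := Set.range fun o : Option (Fin m) => o.elim w a) ?_
    (natCard_compl_range elim_w_a_injective)
  · obtain ⟨g, hg, hgP⟩ := exists_injective_X_mem h
    exact ⟨Set.range g, by rintro _ ⟨o, rfl⟩; exact hgP o, (natCard_compl_range hg).le⟩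
  · intro α hα
    simp [lexUpper, varUpper, Option.exists] at hα ⊢
    grind

end EdgeVar

/-! ### Normality of toric rings -/

/-- A subring `S` of an integrally closed domain `R` is integrally closed, if it contains every
quotient of elements of `S` that lies in `R`. -/
theorem isIntegrallyClosed_of_forall_mul_mem {R : Type*} [CommRing R] [IsDomain R]
    [IsIntegrallyClosed R] {K : Type*} [CommRing K] [Algebra K R] (S : Subalgebra K R)
    (h : ∀ b ∈ S, b ≠ 0 → ∀ c, b * c ∈ S → c ∈ S) : IsIntegrallyClosed S := by
  refine (isIntegrallyClosed_iff (FractionRing S)).2 fun {x} hx => ?_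
  obtain ⟨a, b, hb, rfl⟩ := IsFractionRing.div_surjective (A := S) x
  have hinj : Function.Injective S.val.toRingHom := Subtype.val_injective
  let Φ : FractionRing S →+* FractionRing R := IsFractionRing.map (K := FractionRing S) hinj
  have hΦ : ∀ s : S, Φ (algebraMap S _ s) = algebraMap R _ (s : R) := fun s =>
    IsLocalization.map_eq _ s
  have hb0 : (b : R) ≠ 0 := by simpa using nonZeroDivisors.ne_zero hb
  have hx' : IsIntegral R (Φ (algebraMap S _ a / algebraMap S _ b)) := by
    obtain ⟨f, hf, hf0⟩ := hx
    refine ⟨f.map S.val.toRingHom, hf.map _, ?_⟩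
    rw [Polynomial.eval₂_map]
    have hc : (algebraMap R (FractionRing R)).comp S.val.toRingHom =
        Φ.comp (algebraMap S (FractionRing S)) := RingHom.ext fun s => (hΦ s).symm
    rw [hc, ← Polynomial.hom_eval₂, hf0, map_zero]
  obtain ⟨c, hc⟩ := IsIntegrallyClosed.isIntegral_iff.1 hx'
  have hbc : (b : R) * c = a := by
    refine FaithfulSMul.algebraMap_injective R (FractionRing R) ?_
    rw [map_mul, hc, map_div₀, hΦ, hΦ, mul_div_cancel₀]
    simpa using hb0
  have hcS : c ∈ S := h b b.2 hb0 c (hbc ▸ a.2)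
  refine ⟨⟨c, hcS⟩, ?_⟩
  rw [eq_div_iff (by simpa using nonZeroDivisors.ne_zero hb), ← map_mul]
  congr 1
  exact Subtype.ext ((mul_comm _ _).trans hbc)

section Toric

variable {σ τ τ' K : Type*} [Field K]

theorem mem_range_aeval_toric (A : σ → τ →₀ ℕ) {f : MvPolynomial τ K} :
    f ∈ (aeval fun i => monomial (A i) (1 : K) : MvPolynomial σ K →ₐ[K] _).range ↔
      ∀ γ ∈ f.support, γ ∈ Set.range (toricDegree A) := by
  classical
  constructor
  · rintro ⟨g, rfl⟩ γ hγ
    rw [mem_support_iff, AlgHom.toRingHom_eq_coe, RingHom.coe_coe, coeff_aeval_toric] at hγ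
    obtain ⟨α, hα, -⟩ := Finset.exists_ne_zero_of_sum_ne_zero hγ
    exact ⟨α, (Finset.mem_filter.1 hα).2⟩
  · intro h
    rw [f.as_sum]
    refine Subalgebra.sum_mem _ fun γ hγ => ?_
    obtain ⟨α, rfl⟩ := h γ hγ
    exact ⟨monomial α (coeff _ f), aeval_monomial_toric A α _⟩

/-- The ring of an affine semigroup that is cut out of `ℕ^τ` by the group it generates is normal. -/
theorem isIntegrallyClosed_range_aeval_toric (A : σ → τ →₀ ℕ)
    (h : ∀ α β γ, toricDegree A α + γ = toricDegree A β → γ ∈ Set.range (toricDegree A)) :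
    IsIntegrallyClosed
      (aeval fun i => monomial (A i) (1 : K) : MvPolynomial σ K →ₐ[K] _).range := by
  classical
  refine isIntegrallyClosed_of_forall_mul_mem _ fun b hb hb0 c hbc => ?_
  set S := (aeval fun i => monomial (A i) (1 : K) : MvPolynomial σ K →ₐ[K] _).range
  -- `c₁` is the part of `c` that lies in `S`
  set c₁ := ∑ γ ∈ c.support with γ ∈ Set.range (toricDegree A), monomial γ (coeff γ c)
  set c₂ := ∑ γ ∈ c.support with γ ∉ Set.range (toricDegree A), monomial γ (coeff γ c)
  have hc : c = c₁ + c₂ := by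
    conv_lhs => rw [c.as_sum]
    exact (Finset.sum_filter_add_sum_filter_not _ _ _).symm
  have hc₁ : c₁ ∈ S := by
    refine Subalgebra.sum_mem _ fun γ hγ => ?_
    obtain ⟨α, rfl⟩ := (Finset.mem_filter.1 hγ).2
    exact ⟨monomial α (coeff _ c), aeval_monomial_toric A α _⟩
  have hc₂ : ∀ γ ∈ c₂.support, γ ∉ Set.range (toricDegree A) := by
    intro γ hγ
    obtain ⟨δ, hδ, h'⟩ := Finset.mem_biUnion.1 (support_sum hγ)
    rw [Finset.mem_singleton.1 (support_monomial_subset h')]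
    exact (Finset.mem_filter.1 hδ).2
  have hmem : b * c₂ ∈ S := by
    have : b * c₂ = b * c - b * c₁ := by rw [hc]; ring
    rw [this]
    exact S.sub_mem hbc (S.mul_mem hb hc₁)
  have hzero : b * c₂ = 0 := by
    rw [← support_eq_empty, Finset.eq_empty_iff_forall_notMem]
    intro δ hδ
    obtain ⟨β, hβ, γ, hγ, rfl⟩ := Finset.mem_add.1 (support_mul b c₂ hδ)
    obtain ⟨α, rfl⟩ := (mem_range_aeval_toric A).1 hb β hβ
    obtain ⟨α', hα'⟩ := (mem_range_aeval_toric A).1 hmem _ hδ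
    exact hc₂ γ hγ (h α α' γ hα'.symm)
  rw [hc, (mul_eq_zero.1 hzero).resolve_left hb0, add_zero]
  exact hc₁

theorem ker_aeval_toric_le {A : σ → τ →₀ ℕ} {B : σ → τ' →₀ ℕ}
    (h : ∀ α β, toricDegree A α = toricDegree A β ↔ toricDegree B α = toricDegree B β) :
    RingHom.ker (aeval fun i => monomial (A i) (1 : K) : MvPolynomial σ K →ₐ[K] _) ≤
      RingHom.ker (aeval fun i => monomial (B i) (1 : K) : MvPolynomial σ K →ₐ[K] _) := by
  classical
  intro f hf
  rw [RingHom.mem_ker] at hf ⊢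
  ext γ
  rw [coeff_aeval_toric, coeff_zero]
  by_cases hγ : γ ∈ Set.range (toricDegree B)
  · obtain ⟨α, rfl⟩ := hγ
    simp only [← h]
    rw [← coeff_aeval_toric, hf, coeff_zero]
  · refine Finset.sum_eq_zero fun α hα => absurd ⟨α, (Finset.mem_filter.1 hα).2⟩ hγ

/-- A toric ring depends only on the fibres of the grading. -/
theorem nonempty_range_aeval_toric_equiv {A : σ → τ →₀ ℕ} {B : σ → τ' →₀ ℕ}
    (h : ∀ α β, toricDegree A α = toricDegree A β ↔ toricDegree B α = toricDegree B β) :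
    Nonempty ((aeval fun i => monomial (A i) (1 : K) : MvPolynomial σ K →ₐ[K] _).range ≃+*
      (aeval fun i => monomial (B i) (1 : K) : MvPolynomial σ K →ₐ[K] _).range) := by
  have hker := le_antisymm (ker_aeval_toric_le (K := K) h)
    (ker_aeval_toric_le fun α β => (h α β).symm)
  exact ⟨((Ideal.quotientKerEquivRange (aeval fun i => monomial (A i) (1 : K) :
    MvPolynomial σ K →ₐ[K] _)).symm.toRingEquiv.trans (Ideal.quotEquivOfEq hker)).trans
      (Ideal.quotientKerEquivRange (aeval fun i => monomial (B i) (1 : K) :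
    MvPolynomial σ K →ₐ[K] _)).toRingEquiv⟩

end Toric

/-- Every value between `0` and `∑ j, n j` is a sum of integers between `0` and `n j`. -/
theorem exists_le_sum_eq {m : ℕ} (n : Fin m → ℕ) {N : ℕ} (h : N ≤ ∑ j, n j) :
    ∃ k : Fin m → ℕ, (∀ j, k j ≤ n j) ∧ ∑ j, k j = N := by
  induction m generalizing N with
  | zero => exact ⟨n, fun _ => le_rfl, by simp at h ⊢; omega⟩
  | succ m ih =>
    rw [Fin.sum_univ_succ] at h
    obtain ⟨k, hk, hkN⟩ := ih (fun j => n j.succ) (N := N - min N (n 0)) (by omega)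
    refine ⟨Fin.cons (min N (n 0)) k, Fin.cases (by simp) (by simpa using hk), ?_⟩
    rw [Fin.sum_univ_succ]
    simp
    omega

namespace EdgeVar

variable {m l : ℕ}

/-- The values at an edge of linear forms that are constant on fibres and cut the edge cone out of
the group it generates: `a_j + b_j`, `z_i`, and, for `e ∈ {r, u}` and `h ∈ {p, w}`,
`e + q`, `e + v + ∑ b_j`, `2 e + s + ∑ b_j`; `h + v`, `h + q + ∑ a_j`, `2 h + s + ∑ a_j`;
`e + h + s`. -/
def supportForms : EdgeVar m l → (Fin m ⊕ Fin l ⊕ Fin 16 → ℕ)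
  | p => Sum.elim 0 (Sum.elim 0 ![0, 0, 0, 0, 0, 0, 1, 1, 2, 0, 0, 0, 1, 0, 1, 0])
  | q => Sum.elim 0 (Sum.elim 0 ![1, 0, 0, 1, 0, 0, 0, 1, 0, 0, 1, 0, 0, 0, 0, 0])
  | r => Sum.elim 0 (Sum.elim 0 ![1, 1, 2, 0, 0, 0, 0, 0, 0, 0, 0, 0, 1, 1, 0, 0])
  | s => Sum.elim 0 (Sum.elim 0 ![0, 0, 1, 0, 0, 1, 0, 0, 1, 0, 0, 1, 1, 1, 1, 1])
  | u => Sum.elim 0 (Sum.elim 0 ![0, 0, 0, 1, 1, 2, 0, 0, 0, 0, 0, 0, 0, 0, 1, 1])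
  | v => Sum.elim 0 (Sum.elim 0 ![0, 1, 0, 0, 1, 0, 1, 0, 0, 1, 0, 0, 0, 0, 0, 0])
  | w => Sum.elim 0 (Sum.elim 0 ![0, 0, 0, 0, 0, 0, 0, 0, 0, 1, 1, 2, 0, 1, 0, 1])
  | a j => Sum.elim (Pi.single j 1) (Sum.elim 0 ![0, 0, 0, 0, 0, 0, 0, 1, 1, 0, 1, 1, 0, 0, 0, 0])
  | b j => Sum.elim (Pi.single j 1) (Sum.elim 0 ![0, 1, 1, 0, 1, 1, 0, 0, 0, 0, 0, 0, 0, 0, 0, 0])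
  | z i => Sum.elim 0 (Sum.elim (Pi.single i 1) 0)

/-- The values of the support forms as an exponent vector. -/
def supportDegree (x : EdgeVar m l) : (Fin m ⊕ Fin l ⊕ Fin 16) →₀ ℕ :=
  Finsupp.equivFunOnFinite.symm (supportForms x)

theorem toricDegree_supportDegree (α : EdgeVar m l →₀ ℕ) :
    ⇑(toricDegree supportDegree α) = Sum.elim (fun j => α (a j) + α (b j))
      (Sum.elim (fun i => α (z i)) ![
        α r + α q, α r + α v + ∑ j, α (b j), 2 * α r + α s + ∑ j, α (b j),
        α u + α q, α u + α v + ∑ j, α (b j), 2 * α u + α s + ∑ j, α (b j),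
        α p + α v, α p + α q + ∑ j, α (a j), 2 * α p + α s + ∑ j, α (a j),
        α w + α v, α w + α q + ∑ j, α (a j), 2 * α w + α s + ∑ j, α (a j),
        α r + α p + α s, α r + α w + α s, α u + α p + α s, α u + α w + α s]) := by
  rw [toricDegree_apply]
  funext y
  rw [Finsupp.finsetSum_apply, sum_eq]
  rcases y with j | i | k
  · simp [supportDegree, supportForms, Pi.single_apply]
  · simp [supportDegree, supportForms, Finsupp.single_apply]
  · fin_cases k <;> simp [supportDegree, supportForms] <;> ring

theorem toricDegree_supportDegree_eq_iff (α β : EdgeVar m l →₀ ℕ) :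
    toricDegree supportDegree α = toricDegree supportDegree β ↔ SameFibre α β := by
  rw [← DFunLike.coe_fn_eq, toricDegree_supportDegree, toricDegree_supportDegree, funext_iff]
  constructor
  · intro h
    have h1 := h (.inr (.inr 0))
    have h2 := h (.inr (.inr 9))
    have h3 := h (.inr (.inr 12))
    have h4 := h (.inr (.inr 15))
    have h5 := h (.inr (.inr 7))
    have h6 := h (.inr (.inr 4))
    simp at h1 h2 h3 h4 h5 h6
    refine ⟨fun i => h (.inr (.inl i)), fun j => h (.inl j), ?_, ?_, ?_, ?_, ?_, ?_⟩ <;> omega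
  · rintro h (j | i | k)
    · exact h.ab j
    · exact h.z i
    · have h1 := h.qr
      have h2 := h.vw
      have h3 := h.prs
      have h4 := h.uws
      have h5 := h.pqa
      have h6 := h.uvb
      have h7 := h.sum_ab
      fin_cases k <;> simp <;> omega

/-- The semigroup of the edge ring is cut out of `ℕ^τ` by the group it generates. -/
theorem mem_range_toricDegree_supportDegree (α β : EdgeVar m l →₀ ℕ) {γ}
    (h : toricDegree supportDegree α + γ = toricDegree supportDegree β) :
    γ ∈ Set.range (toricDegree (supportDegree : EdgeVar m l → _)) := by
  suffices h' : ∃ κ : EdgeVar m l →₀ ℕ, SameFibre (α + κ) β by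
    obtain ⟨κ, hκ⟩ := h'
    refine ⟨κ, ?_⟩
    rw [← toricDegree_supportDegree_eq_iff, map_add, ← h] at hκ
    exact add_left_cancel hκ
  have hle : ∀ y, toricDegree supportDegree α y ≤ toricDegree supportDegree β y := fun y => by
    rw [← h]
    simp
  simp only [toricDegree_supportDegree] at hle
  have hz : ∀ i, α (EdgeVar.z i) ≤ β (EdgeVar.z i) := fun i => hle (.inr (.inl i))
  have hab : ∀ j, α (EdgeVar.a j) + α (EdgeVar.b j) ≤ β (EdgeVar.a j) + β (EdgeVar.b j) :=
    fun j => hle (.inl j)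
  have hsum := Finset.sum_le_sum fun j (_ : j ∈ Finset.univ) => hab j
  rw [Finset.sum_add_distrib, Finset.sum_add_distrib] at hsum
  have hk := fun k => hle (.inr (.inr k))
  simp [Fin.forall_fin_succ] at hk
  -- The coordinates of `β - α` in the group; along the kernel of the grading, `r` and `u` may be
  -- lowered by `ε`, and `p` and `w` by `ζ`.
  set A : ℤ := ∑ j, (β (EdgeVar.a j) : ℤ) - ∑ j, (α (EdgeVar.a j) : ℤ) with hA
  set B : ℤ := ∑ j, (β (EdgeVar.b j) : ℤ) - ∑ j, (α (EdgeVar.b j) : ℤ) with hB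
  obtain ⟨E, hE⟩ : ∃ E : ℤ, E = min ((β r : ℤ) - α r) ((β u : ℤ) - α u) := ⟨_, rfl⟩
  obtain ⟨Z, hZ⟩ : ∃ Z : ℤ, Z = min ((β p : ℤ) - α p) ((β w : ℤ) - α w) := ⟨_, rfl⟩
  obtain ⟨ε, hε⟩ : ∃ ε : ℤ, ε = min E (Z + A) := ⟨_, rfl⟩
  obtain ⟨ζ, hζ⟩ : ∃ ζ : ℤ, ζ = min Z (E + B) := ⟨_, rfl⟩
  set n : Fin m → ℕ := fun j =>
    β (EdgeVar.a j) + β (EdgeVar.b j) - (α (EdgeVar.a j) + α (EdgeVar.b j)) with hn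
  have hnAB : ((∑ j, n j : ℕ) : ℤ) = A + B := by
    rw [hA, hB, Nat.cast_sum, ← Finset.sum_sub_distrib, ← Finset.sum_sub_distrib,
      ← Finset.sum_add_distrib]
    refine Finset.sum_congr rfl fun j _ => ?_
    have := hab j
    simp only [hn]
    omega
  have hcast : ∀ (γ : EdgeVar m l →₀ ℕ) (c : Fin m → EdgeVar m l),
      ((∑ j, γ (c j) : ℕ) : ℤ) = ∑ j, (γ (c j) : ℤ) := fun γ c => Nat.cast_sum _ _
  rw [← hcast, ← hcast] at hA hB
  obtain ⟨k, hkn, hkN⟩ := exists_le_sum_eq n (N := (ζ - ε + A).toNat) (by omega)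
  refine ⟨Finsupp.equivFunOnFinite.symm fun x => match x with
    | p => ((β p : ℤ) - α p - ζ).toNat
    | q => ((β q : ℤ) - α q + ε).toNat
    | r => ((β r : ℤ) - α r - ε).toNat
    | s => ((β s : ℤ) - α s + ε + ζ).toNat
    | u => ((β u : ℤ) - α u - ε).toNat
    | v => ((β v : ℤ) - α v + ζ).toNat
    | w => ((β w : ℤ) - α w - ζ).toNat
    | a j => k j
    | b j => n j - k j
    | z i => β (z i) - α (z i), fun i => ?_, fun j => ?_, ?_, ?_, ?_, ?_, ?_, ?_⟩
  all_goals simp [Finset.sum_add_distrib]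
  · have := hz i
    omega
  · have := hab j
    have := hkn j
    simp only [hn] at this ⊢
    omega
  · omega
  · omega
  · omega
  · omega
  · omega
  · have hsub : ∑ j, (n j - k j) = ∑ j, n j - ∑ j, k j :=
      Finset.sum_tsub_distrib _ fun j _ => hkn j
    omega

theorem isIntegrallyClosed_range_aeval_vertexDegree (K : Type*) [Field K] :
    IsIntegrallyClosed (aeval fun x : EdgeVar m l => monomial (vertexDegree x) (1 : K) :
      MvPolynomial (EdgeVar m l) K →ₐ[K] _).range := by
  obtain ⟨e⟩ := nonempty_range_aeval_toric_equiv (K := K) (A := supportDegree)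
    (B := (vertexDegree : EdgeVar m l → _)) fun α β =>
      (toricDegree_supportDegree_eq_iff α β).trans (toricDegree_eq_iff α β).symm
  have := isIntegrallyClosed_range_aeval_toric (K := K) (supportDegree : EdgeVar m l → _)
    fun α β γ => mem_range_toricDegree_supportDegree α β
  exact IsIntegrallyClosed.of_equiv e

end EdgeVar

/-! ### The edge ideals -/

namespace EdgeVar

variable {m l : ℕ}

theorem edgeMonomial_edgeEquiv (K : Type*) [Field K] (x : EdgeVar m l) :
    edgeMonomial K (pendantGraph (m + 1) (l + 6 + m)) (edgeEquiv m l x) =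
      monomial (vertexDegree x) 1 := by
  change (X (src x) * X (tgt x) : MvPolynomial _ K) = _
  rw [X, X, monomial_mul, one_mul]
  rfl

theorem edgeMonomial_eq (K : Type*) [Field K] :
    edgeMonomial K (pendantGraph (m + 1) (l + 6 + m)) =
      fun i => monomial (vertexDegree ((edgeEquiv m l).symm i)) 1 := by
  funext i
  rw [← edgeMonomial_edgeEquiv, Equiv.apply_symm_apply]

theorem isIntegrallyClosed_edgeRing (K : Type*) [Field K] :
    IsIntegrallyClosed (edgeRing K (pendantGraph (m + 1) (l + 6 + m))) := by
  have h : edgeRing K (pendantGraph (m + 1) (l + 6 + m)) =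
      (aeval fun x : EdgeVar m l => monomial (vertexDegree x) (1 : K)).range := by
    rw [edgeRing, edgeMonomial_eq, ← Algebra.adjoin_range_eq_range_aeval]
    congr 1
    exact (edgeEquiv m l).symm.surjective.range_comp fun x => monomial (vertexDegree x) (1 : K)
  rw [h]
  exact isIntegrallyClosed_range_aeval_vertexDegree K

/-- A monomial ideal is the initial ideal of the toric ideal, if its monomials are not minimal in
their fibres and no fibre contains two other monomials. -/
theorem initialIdeal_toricIdeal (K : Type*) [Field K]
    (M : MonomialOrder (pendantGraph (m + 1) (l + 6 + m)).edgeSet) {U : Set (EdgeVar m l →₀ ℕ)}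
    (h₁ : ∀ α ∈ U, ∃ β : EdgeVar m l →₀ ℕ, β.equivMapDomain (edgeEquiv m l) ≺[M]
      α.equivMapDomain (edgeEquiv m l) ∧ SameFibre β α)
    (h₂ : ∀ α β, α ∉ U → β ∉ U → SameFibre α β → α = β) :
    initialIdeal M (toricIdeal K (pendantGraph (m + 1) (l + 6 + m))) =
      monoIdeal K (Finsupp.equivMapDomain (edgeEquiv m l) '' U) := by
  have hdeg : ∀ α : EdgeVar m l →₀ ℕ,
      toricDegree (fun i => vertexDegree ((edgeEquiv m l).symm i))
        (α.equivMapDomain (edgeEquiv m l)) = toricDegree vertexDegree α := fun α => by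
    have := Fintype.ofEquiv _ (edgeEquiv m l)
    rw [toricDegree_apply, toricDegree_apply, ← (edgeEquiv m l).sum_comp]
    simp
  rw [toricIdeal, edgeMonomial_eq, initialIdeal_ker_toric]
  congr 1
  refine nonminimal_eq M (edgeEquiv m l) _ U (fun α hα => ?_) fun α β hα hβ h => ?_
  · obtain ⟨β, hlt, hβ⟩ := h₁ α hα
    refine ⟨β, hlt, ?_⟩
    rw [hdeg, hdeg, toricDegree_eq_iff]
    exact hβ
  · rw [hdeg, hdeg, toricDegree_eq_iff] at h
    exact h₂ α β hα hβ h

end EdgeVar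

end EdgeRing

end

theorem theorem0p1 (f d : ℕ) (hf : 6 ≤ f) (hd : f ≤ d) :
    ∃ G : SimpleGraph (Fin d),
      G.Connected ∧ ¬ G.IsBipartite ∧
      -- `G` is `G_{d-f+6}` with `f - 6` pendant edges attached at the vertex `1`
      G = EdgeRing.pendantGraph (d - f + 1) d ∧
      ∃ rev lex : MonomialOrder.{0, 0} G.edgeSet,
        EdgeRing.IsReverseLexOrder rev ∧ EdgeRing.IsLexOrder lex ∧
        ∀ (K : Type*) [Field K],
          IsIntegrallyClosed (EdgeRing.edgeRing K G) ∧
          EdgeRing.depthQuotient (EdgeRing.initialIdeal rev (EdgeRing.toricIdeal K G)) = (f : ℕ∞) ∧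
          EdgeRing.IsCohenMacaulayQuotient
            (EdgeRing.initialIdeal lex (EdgeRing.toricIdeal K G)) := by
  obtain ⟨l, rfl⟩ := Nat.exists_eq_add_of_le' hf
  obtain ⟨m, rfl⟩ := Nat.exists_eq_add_of_le hd
  rw [show l + 6 + m - (l + 6) + 1 = m + 1 by omega]
  obtain ⟨x, hx⟩ := EdgeRing.exists_equiv_fin_of_rank
    (EdgeRing.EdgeVar.revRank : EdgeRing.EdgeVar m l → ℕ) EdgeRing.EdgeVar.revRank_injective
  obtain ⟨y, hy⟩ := EdgeRing.exists_equiv_fin_of_rank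
    (EdgeRing.EdgeVar.lexRank : EdgeRing.EdgeVar m l → ℕ) EdgeRing.EdgeVar.lexRank_injective
  refine ⟨_, EdgeRing.EdgeVar.connected, EdgeRing.EdgeVar.not_isBipartite, rfl,
    EdgeRing.revLexOrder (x.trans (EdgeRing.EdgeVar.edgeEquiv m l)),
    EdgeRing.lexOrder (y.trans (EdgeRing.EdgeVar.edgeEquiv m l)),
    ⟨_, _, EdgeRing.revLexOrder_lt_iff _⟩, ⟨_, _, EdgeRing.lexOrder_lt_iff _⟩, fun K _ =>
    ⟨EdgeRing.EdgeVar.isIntegrallyClosed_edgeRing K, ?_, ?_⟩⟩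
  · rw [EdgeRing.EdgeVar.initialIdeal_toricIdeal K _
      (fun α hα => EdgeRing.EdgeVar.exists_smaller_of_mem_revUpper hx _ hα)
      (fun α β hα hβ h => EdgeRing.EdgeVar.eq_of_notMem_revUpper hα hβ h),
      EdgeRing.depthQuotient_monoIdeal_equiv, EdgeRing.EdgeVar.depthQuotient_revUpper, add_comm]
  · rw [EdgeRing.EdgeVar.initialIdeal_toricIdeal K _
      (fun α hα => EdgeRing.EdgeVar.exists_smaller_of_mem_lexUpper hy _ hα)
      (fun α β hα hβ h => EdgeRing.EdgeVar.eq_of_notMem_lexUpper hα hβ h),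
      EdgeRing.IsCohenMacaulayQuotient, EdgeRing.depthQuotient_monoIdeal_equiv,
      EdgeRing.ringKrullDim_monoIdeal_equiv, EdgeRing.EdgeVar.depthQuotient_lexUpper,
      EdgeRing.EdgeVar.ringKrullDim_lexUpper]
    rfl
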